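/- A QAP instance of order $n\ge 1$ consists of symmetric $n\times n$ matrices $A=(a_{ik})$, $B=(b_{jl})$ and an arbitrary $n\times n$ matrix $C=(c_{ij})$; it asks for the minimum of $\sum_{i,j,k,l}a_{ik}b_{jl}x_{ij}x_{kl}+\sum_{i,j}c_{ij}x_{ij}$ over all permutation matrices $X=(x_{ij})$. A QSPP instance $(G,s,t,c,Q)$ consists of a directed multigraph $G$ with vertices $s,t$, nonnegative arc costs $c_e$ and a nonnegative symmetric matrix $Q=(q_{ef})$ with zero diagonal indexed by the arcs, such that no directed cycle of $G$ has total cost zero; it asks for the minimum of $\sum_{e,f\in P}q_{ef}+\sum_{e\in P}c_e$ over all $s$-$t$ paths $P$ (walks with at least one arc and without repeated vertices, given by their arcs). Given a QAP instance of order $n$ and numbers $M,\sigma,\tau$, let $G$ have the vertices $w_1,\dots,w_{n+1}$ and, for all $i,j\in\{1,\dots,n\}$, an arc $(w_j,w_{j+1})^i$, the $i$-th of $n$ parallel arcs from $w_j$ to $w_{j+1}$; let $s=w_1$, $t=w_{n+1}$. The arc $e=(w_j,w_{j+1})^i$ has linear cost $c_{ij}+a_{ii}b_{jj}+\tau$.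 For $e=(w_j,w_{j+1})^i$ and $f=(w_l,w_{l+1})^k$ let $q_{ef}=0$ if $e=f$, $q_{ef}=M$ if $e\ne f$ and ($i=k$ or $j=l$), and $q_{ef}=a_{ik}b_{jl}+\sigma$ if $i\neq k$ and $j\ne l$. So $G$ has $n+1$ vertices and $n^2$ arcs. Put $\kappa=n(n-1)\sigma+n\tau$. **Theorem.** There is a polynomial-time reduction from the QAP to the QSPP on directed multigraphs. More precisely: (a) For every real QAP instance there are real numbers $M,\sigma,\tau$, with $\sigma=\tau=0$ whenever all numbers $c_{ij}+a_{ii}b_{jj}$ and all numbers $a_{ik}b_{jl}$ with $i\ne k$, $j\ne l$ are nonnegative, such that the construction yields a QSPP instance with the following properties. For every permutation $\pi$, the arcs $(w_{\pi(i)},w_{\pi(i)+1})^{i}$, $i=1,\dots,n$, form an $s$-$t$ path whose cost is less than $M$ and equals the QAP objective value of $\pi$ plus $\kappa$. Conversely, every $s$-$t$ path of cost less than $M$ arises in this way from exactly one $\pi$. A number $v$ is the optimal value of the QAP instance if and only if $v+\kappa$ is the optimal value of the QSPP instance. In particular, the objective values are equal if $\sigma=\tau=0$. (b) For rational QAP instances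 $I$, rational numbers $M(I),\sigma(I),\tau(I)$ as in (a) can be chosen such that the map that sends a QAP instance $I$ with a rational threshold $K$ to the constructed QSPP instance with the threshold $K+\kappa(I)$ is computable in time polynomial in the bit length of the input (on a random access machine with logarithmic cost, rationals being given as fractions of integers in binary), and $I$ has an assignment of cost at most $K$ if and only if the constructed QSPP instance has an $s$-$t$ path of cost at most $K+\kappa(I)$. -/

import Mathlib

/-! ### The quadratic assignment problem -/

/-- An instance of the quadratic assignment problem of order `n ≥ 1`: symmetric matrices `A`
(flows) and `B` (distances) and an arbitrary matrix `C` (placement costs). -/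
structure QAP (R : Type) where
  n : ℕ
  n_pos : 0 < n
  A : Matrix (Fin n) (Fin n) R
  B : Matrix (Fin n) (Fin n) R
  C : Matrix (Fin n) (Fin n) R
  A_symm : A.IsSymm
  B_symm : B.IsSymm

/-- The objective `∑ a_{ik} b_{jl} x_{ij} x_{kl} + ∑ c_{ij} x_{ij}`. -/
def QAP.objective {R : Type} [CommRing R] (I : QAP R) (X : Matrix (Fin I.n) (Fin I.n) R) : R :=
  (∑ i, ∑ j, ∑ k, ∑ l, I.A i k * I.B j l * X i j * X k l) + ∑ i, ∑ j, I.C i j * X i j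

/-- The cost of the assignment `π` (facility `i` is placed at location `π i`): the objective at
the permutation matrix whose entry `(i, j)` is `1` if `π i = j` and `0` otherwise. -/
def QAP.cost {R : Type} [CommRing R] (I : QAP R) (π : Equiv.Perm (Fin I.n)) : R :=
  I.objective (π.permMatrix R)

/-! ### The quadratic shortest path problem on directed multigraphs -/

/-- The data `(G, s, t, c, Q)` of a quadratic shortest path problem.  The multigraph `G` has
vertices `Fin nV` and arcs `Fin nA`; arc `e` goes from `src e` to `tgt e`, and several arcs may
share both end points. -/
structure QSPP (R : Type) where
  nV : ℕ
  nA : ℕ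
  src : Fin nA → Fin nV
  tgt : Fin nA → Fin nV
  s : Fin nV
  t : Fin nV
  c : Fin nA → R
  Q : Matrix (Fin nA) (Fin nA) R

namespace QSPP

/-- `P` is the arc sequence of a walk from `u` to `v`. -/
def IsWalk {R : Type} (J : QSPP R) : Fin J.nV → List (Fin J.nA) → Fin J.nV → Prop
  | u, [], v => u = v
  | u, e :: P, v => J.src e = u ∧ J.IsWalk (J.tgt e) P v

/-- `P` is the arc sequence of an `s`-`t` path: a walk with at least one arc and without repeated
vertices. -/
def IsPath {R : Type} (J : QSPP R) (P : List (Fin J.nA)) : Prop :=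
  P ≠ [] ∧ J.IsWalk J.s P J.t ∧ (J.s :: P.map J.tgt).Nodup

/-- `P` is the arc sequence of a directed cycle. -/
def IsCycle {R : Type} (J : QSPP R) (P : List (Fin J.nA)) : Prop :=
  P ≠ [] ∧ (∃ u, J.IsWalk u P u) ∧ (P.map J.tgt).Nodup

/-- The quadratic cost `∑_{e, f ∈ P} q_{ef} + ∑_{e ∈ P} c_e`. -/
def cost {R : Type} [CommRing R] (J : QSPP R) (P : List (Fin J.nA)) : R :=
  (P.map fun e => (P.map fun f => J.Q e f).sum).sum + (P.map J.c).sum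

/-- The standing assumptions on an instance: nonnegative linear costs, a nonnegative symmetric
interaction matrix with zero diagonal, and no directed cycle of total cost zero. -/
structure Valid {R : Type} [CommRing R] [LinearOrder R] (J : QSPP R) : Prop where
  c_nonneg : ∀ e, 0 ≤ J.c e
  Q_nonneg : ∀ e f, 0 ≤ J.Q e f
  Q_symm : J.Q.IsSymm
  Q_diag : ∀ e, J.Q e e = 0
  no_zero_cycle : ∀ P, J.IsCycle P → J.cost P ≠ 0

end QSPP

/-! ### The construction -/

namespace QAP

/-- The multigraph on vertices `w_0, …, w_n` with `n` parallel arcs from `w_j` to `w_{j+1}` for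
each location `j`.  The arc number `j * n + i` is the `i`-th arc from `w_j` to `w_{j+1}`; it stands
for placing facility `i` at location `j`.  Its linear cost is `c_{ij} + a_{ii} b_{jj}`, raised by
`τ`.  Two distinct arcs that share the facility or the location have interaction cost `M`; other
distinct arcs have interaction cost `a_{ik} b_{jl}`, raised by `σ`. -/
def toQSPP {R : Type} [CommRing R] (I : QAP R) (M σ τ : R) : QSPP R where
  nV := I.n + 1
  nA := I.n * I.n
  src e := e.divNat.castSucc
  tgt e := e.divNat.succ
  s := 0
  t := Fin.last I.n
  c e := I.C e.modNat e.divNat + I.A e.modNat e.modNat * I.B e.divNat e.divNat + τ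
  Q e f :=
    if e = f then 0
    else if e.modNat = f.modNat ∨ e.divNat = f.divNat then M
    else I.A e.modNat f.modNat * I.B e.divNat f.divNat + σ

/-- The arc sequence of the path that belongs to the assignment `π`: for each location `j` in turn
the arc of the facility `π⁻¹ j` that is placed there. -/
def arcPath {n : ℕ} (π : Equiv.Perm (Fin n)) : List (Fin (n * n)) :=
  List.ofFn fun j => finProdFinEquiv (j, π.symm j)

/-- The total amount by which the shifts `σ` and `τ` raise the cost of the path of an
assignment. -/
def offset {R : Type} [CommRing R] (I : QAP R) (σ τ : R) : R :=
  (I.n : R) * ((I.n : R) - 1) * σ + (I.n : R) * τ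

/-- All costs that the construction uses are nonnegative without any shift. -/
def NonnegCosts {R : Type} [CommRing R] [LinearOrder R] (I : QAP R) : Prop :=
  (∀ i j, 0 ≤ I.C i j + I.A i i * I.B j j) ∧
    ∀ i j k l, i ≠ k → j ≠ l → 0 ≤ I.A i k * I.B j l

/-- With the parameters `M`, `σ`, `τ` the construction turns the instance `I` into a legal instance
of the quadratic shortest path problem with the same objective values, up to an additive constant
that vanishes if the costs are nonnegative to begin with. -/
structure ReducesWith {R : Type} [CommRing R] [LinearOrder R] (I : QAP R) (M σ τ : R) :
    Prop where
  valid : (I.toQSPP M σ τ).Valid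
  no_shift : I.NonnegCosts → σ = 0 ∧ τ = 0
  isPath_arcPath : ∀ π : Equiv.Perm (Fin I.n), (I.toQSPP M σ τ).IsPath (arcPath π)
  cost_arcPath : ∀ π : Equiv.Perm (Fin I.n),
    (I.toQSPP M σ τ).cost (arcPath π) = I.cost π + I.offset σ τ
  cost_arcPath_lt : ∀ π : Equiv.Perm (Fin I.n), (I.toQSPP M σ τ).cost (arcPath π) < M
  eq_arcPath_of_cost_lt : ∀ P, (I.toQSPP M σ τ).IsPath P → (I.toQSPP M σ τ).cost P < M →
    ∃! π : Equiv.Perm (Fin I.n), P = arcPath π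
  optimal_value : ∀ v : R,
    IsLeast {x | ∃ π : Equiv.Perm (Fin I.n), x = I.cost π} v ↔
      IsLeast {x | ∃ P, (I.toQSPP M σ τ).IsPath P ∧ x = (I.toQSPP M σ τ).cost P}
        (v + I.offset σ τ)

end QAP

/-! ### Random access machines with logarithmic cost

The machine has integer registers `r_0, r_1, …` with indirect addressing, a read-only input and a
write-only output.  Each operation is charged one plus the bit lengths of its operands and of the
addresses that it computes, which makes the running time polynomially related to that of Turing
machines. -/

namespace RAM

/-- The number of binary digits of `|z|`. -/
def bits (z : ℤ) : ℕ := z.natAbs.size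

/-- The length of a list of integers written in binary. -/
def bitLength (l : List ℤ) : ℕ := (l.map fun z => bits z + 1).sum

inductive Instr
  /-- `r_i := z` -/
  | const (i : ℕ) (z : ℤ)
  /-- `r_i := r_j` -/
  | copy (i j : ℕ)
  /-- `r_i := r_j + r_k` -/
  | add (i j k : ℕ)
  /-- `r_i := r_j - r_k` -/
  | sub (i j k : ℕ)
  /-- `r_i := r_j * r_k` -/
  | mul (i j k : ℕ)
  /-- `r_i := r_(r_j)` -/
  | load (i j : ℕ)
  /-- `r_(r_i) := r_j` -/
  | store (i j : ℕ)
  /-- `r_i :=` the input number at position `r_j` (zero beyond the end) -/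
  | read (i j : ℕ)
  /-- append `r_i` to the output -/
  | write (i : ℕ)

structure State where
  reg : ℕ → ℤ
  out : List ℤ

/-- `r_i := z`. -/
def State.set (S : State) (i : ℕ) (z : ℤ) : State := ⟨Function.update S.reg i z, S.out⟩

/-- All registers are zero and nothing has been written. -/
def State.init : State := ⟨fun _ => 0, []⟩

/-- The effect of an instruction when the input is `inp`. -/
def Instr.step (inp : List ℤ) (S : State) : Instr → State
  | const i z => S.set i z
  | copy i j => S.set i (S.reg j)
  | add i j k => S.set i (S.reg j + S.reg k)
  | sub i j k => S.set i (S.reg j - S.reg k)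
  | mul i j k => S.set i (S.reg j * S.reg k)
  | load i j => S.set i (S.reg (S.reg j).toNat)
  | store i j => S.set (S.reg i).toNat (S.reg j)
  | read i j => S.set i (inp.getD (S.reg j).toNat 0)
  | write i => ⟨S.reg, S.out ++ [S.reg i]⟩

/-- The logarithmic cost of an instruction. -/
def Instr.cost (inp : List ℤ) (S : State) : Instr → ℕ
  | const _ z => 1 + bits z
  | copy _ j => 1 + bits (S.reg j)
  | add _ j k => 1 + bits (S.reg j) + bits (S.reg k)
  | sub _ j k => 1 + bits (S.reg j) + bits (S.reg k)
  | mul _ j k => 1 + bits (S.reg j) + bits (S.reg k)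
  | load _ j => 1 + bits (S.reg j) + bits (S.reg (S.reg j).toNat)
  | store i j => 1 + bits (S.reg i) + bits (S.reg j)
  | read _ j => 1 + bits (S.reg j) + bits (inp.getD (S.reg j).toNat 0)
  | write i => 1 + bits (S.reg i)

/-- Programs.  The tests of `ite i p q` and `loop i p` (a while loop) are `0 < r_i`. -/
inductive Prog
  | skip
  | instr (a : Instr)
  | seq (p q : Prog)
  | ite (i : ℕ) (p q : Prog)
  | loop (i : ℕ) (p : Prog)

/-- `Exec inp p S T c`: on input `inp` the program `p`, started in state `S`, halts in state `T`
after running for time `c`. -/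
inductive Exec (inp : List ℤ) : Prog → State → State → ℕ → Prop
  | skip (S : State) : Exec inp .skip S S 1
  | instr (a : Instr) (S : State) : Exec inp (.instr a) S (a.step inp S) (a.cost inp S)
  | seq {p q : Prog} {S T U : State} {c d : ℕ} :
      Exec inp p S T c → Exec inp q T U d → Exec inp (.seq p q) S U (c + d)
  | ite_pos {i : ℕ} {p q : Prog} {S T : State} {c : ℕ} :
      0 < S.reg i → Exec inp p S T c → Exec inp (.ite i p q) S T (1 + bits (S.reg i) + c)
  | ite_neg {i : ℕ} {p q : Prog} {S T : State} {c : ℕ} :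
      ¬ 0 < S.reg i → Exec inp q S T c → Exec inp (.ite i p q) S T (1 + bits (S.reg i) + c)
  | loop_pos {i : ℕ} {p : Prog} {S T U : State} {c d : ℕ} :
      0 < S.reg i → Exec inp p S T c → Exec inp (.loop i p) T U d →
        Exec inp (.loop i p) S U (1 + bits (S.reg i) + c + d)
  | loop_neg {i : ℕ} {p : Prog} {S : State} :
      ¬ 0 < S.reg i → Exec inp (.loop i p) S S (1 + bits (S.reg i))

/-- A function is computable in polynomial time with respect to encodings by lists of integers if
one program turns every code of every `a` into a code of `f a`, in time polynomial in the bit length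
of the code of `a`.  (An object may have several codes.) -/
def PolyTimeComputable {α β : Type} (encα : α → List ℤ → Prop) (encβ : β → List ℤ → Prop)
    (f : α → β) : Prop :=
  ∃ (p : Prog) (b : Polynomial ℕ), ∀ a l, encα a l →
    ∃ T c, Exec l p State.init T c ∧ encβ (f a) T.out ∧ c ≤ b.eval (bitLength l)

/-- `f` is a polynomial-time reduction from the decision problem with yes-instances `yesα` to the
one with yes-instances `yesβ`. -/
def IsPolyTimeReduction {α β : Type} (encα : α → List ℤ → Prop) (yesα : α → Prop)
    (encβ : β → List ℤ → Prop) (yesβ : β → Prop) (f : α → β) : Prop :=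
  PolyTimeComputable encα encβ f ∧ ∀ a, yesα a ↔ yesβ (f a)

/-- A list of rationals is written as the list of numerators and positive denominators of fractions
for them, not necessarily in lowest terms. -/
inductive EncRats : List ℚ → List ℤ → Prop
  | nil : EncRats [] []
  | cons {q : ℚ} {qs : List ℚ} {num den : ℤ} {l : List ℤ} :
      0 < den → q = (num : ℚ) / (den : ℚ) → EncRats qs l → EncRats (q :: qs) (num :: den :: l)

/-- The entries of a matrix, row by row. -/
def rows {m n : ℕ} (A : Matrix (Fin m) (Fin n) ℚ) : List ℚ :=
  (List.ofFn fun i => List.ofFn fun j => A i j).flatten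

end RAM

/-! ### The decision problems -/

/-- Codes of a quadratic assignment instance with a threshold: `n`, then `A`, `B`, `C` and the
threshold. -/
def QAP.Enc (x : QAP ℚ × ℚ) (l : List ℤ) : Prop :=
  ∃ l', l = (x.1.n : ℤ) :: l' ∧
    RAM.EncRats (RAM.rows x.1.A ++ RAM.rows x.1.B ++ RAM.rows x.1.C ++ [x.2]) l'

/-- Is there an assignment of cost at most the threshold? -/
def QAP.Yes (x : QAP ℚ × ℚ) : Prop := ∃ π : Equiv.Perm (Fin x.1.n), x.1.cost π ≤ x.2

/-- Codes of a quadratic shortest path instance with a threshold: the numbers of vertices and of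
arcs, `s`, `t`, the end points of all arcs, then `c`, `Q` and the threshold. -/
def QSPP.Enc (y : QSPP ℚ × ℚ) (l : List ℤ) : Prop :=
  ∃ l', l = [(y.1.nV : ℤ), (y.1.nA : ℤ), ((y.1.s : ℕ) : ℤ), ((y.1.t : ℕ) : ℤ)] ++
      (List.ofFn fun e => [((y.1.src e : ℕ) : ℤ), ((y.1.tgt e : ℕ) : ℤ)]).flatten ++ l' ∧
    RAM.EncRats (List.ofFn y.1.c ++ RAM.rows y.1.Q ++ [y.2]) l'

/-- Is this a legal instance that has an `s`-`t` path of cost at most the threshold? -/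
def QSPP.Yes (y : QSPP ℚ × ℚ) : Prop := y.1.Valid ∧ ∃ P, y.1.IsPath P ∧ y.1.cost P ≤ y.2

/-! Every arc leads from one layer to the next. Hence there are no directed cycles, and an `s`-`t`
path consists of exactly one arc per layer, that is, of a choice of a facility `g j` for every
location `j` (`exists_choicePath_of_isPath`). If `g` is injective, it is the inverse of an
assignment. Then no two arcs of the path conflict, the diagonal products `a_{ii} b_{jj}` are paid as
linear costs, and the shifts contribute `σ` for each of the `n (n - 1)` ordered pairs and `τ` for
each of the `n` arcs (`cost_toQSPP_arcPath_eq`). If `g` is not injective, some pair of arcs pays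
`M`, and the path costs at least `M` because all other costs are nonnegative
(`penalty_le_cost_choicePath`). The shifts are sums of negative parts, so they vanish if nothing is
negative. `M` is one more than the sum of all shifted costs, hence larger than the cost of every
assignment path.

For the running time, the parameters and the entries of the output are built from coded numbers by
arithmetic, case distinctions and a bounded number of nested sums over indices below `n`. It
suffices that the functions computable in polynomial time are closed under these operations. Over
the integers the main step is `IntComputable.fold`: one more addition or multiplication lengthens
the accumulator only by the length of the new operand plus one, so `n` passes keep the lengths
polynomial. Rationals are handled as unreduced fractions, and an indexed sum is put over the product
of all denominators (`RatComputable.sum`). Loops of length `n` are affordable since the code itself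
has length at least `n` (`Code.n_le_size`). -/

namespace QSPP

/-! ### Walks in layered multigraphs -/

variable {R : Type}

/-- In a walk along the layers of a multigraph every arc leads to the next layer. -/
theorem IsWalk.val_eq_add_length {J : QSPP R} (h : ∀ e, (J.tgt e : ℕ) = J.src e + 1) :
    ∀ {u v : Fin J.nV} {P : List (Fin J.nA)}, J.IsWalk u P v → (v : ℕ) = u + P.length
  | u, v, [], hw => by
    have hw : u = v := hw
    simp [hw]
  | u, v, e :: P, hw => by
    obtain ⟨rfl, hP⟩ := hw
    rw [hP.val_eq_add_length h, h e, List.length_cons]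
    omega

theorem IsWalk.map_src_eq_range' {J : QSPP R} (h : ∀ e, (J.tgt e : ℕ) = J.src e + 1) :
    ∀ {u v : Fin J.nV} {P : List (Fin J.nA)}, J.IsWalk u P v →
      P.map (fun e => (J.src e : ℕ)) = List.range' u P.length
  | _, _, [], _ => by simp
  | u, v, e :: P, hw => by
    obtain ⟨rfl, hP⟩ := hw
    rw [List.map_cons, hP.map_src_eq_range' h, h e, List.length_cons, List.range'_succ]

/-- The start at an arbitrary layer `k` makes induction on the number of remaining arcs possible;
only `k = 0` is needed later. -/
theorem isWalk_drop_ofFn (J : QSPP R) {n : ℕ} {f : Fin n → Fin J.nA}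
    (hs : ∀ j, (J.src (f j) : ℕ) = j) (ht : ∀ j, (J.tgt (f j) : ℕ) = j + 1) {k : ℕ} (hk : k ≤ n)
    {u v : Fin J.nV} (hu : (u : ℕ) = k) (hv : (v : ℕ) = n) :
    J.IsWalk u ((List.ofFn f).drop k) v := by
  induction hd : n - k generalizing k u with
  | zero =>
    rw [List.drop_eq_nil_of_le (by rw [List.length_ofFn]; omega)]
    exact Fin.ext (by omega)
  | succ d ih =>
    have hlt : k < n := by omega
    rw [List.drop_eq_getElem_cons (by rwa [List.length_ofFn]), List.getElem_ofFn]
    exact ⟨Fin.ext ((hs _).trans hu.symm), ih hlt (ht _) (by omega)⟩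

end QSPP

/-! ### Paths of the construction and their costs -/

namespace QAP

section Ring

variable {R : Type} [CommRing R]

theorem cost_eq (I : QAP R) (π : Equiv.Perm (Fin I.n)) :
    I.cost π = (∑ i, ∑ k, I.A i k * I.B (π i) (π k)) + ∑ i, I.C i (π i) := by
  have hX : ∀ i j, π.permMatrix R i j = if π i = j then (1 : R) else 0 := by
    intro i j
    simp [Equiv.Perm.permMatrix, PEquiv.toMatrix_apply, Equiv.toPEquiv_apply, eq_comm]
  simp only [QAP.cost, QAP.objective, hX, mul_ite, mul_one, mul_zero, Finset.sum_ite_eq,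
    Finset.mem_univ, if_true]
  congr 1
  refine Finset.sum_congr rfl fun i _ => ?_
  rw [Finset.sum_comm]
  simp

theorem divNat_finProdFinEquiv {m n : ℕ} (x : Fin m × Fin n) :
    (finProdFinEquiv x).divNat = x.1 :=
  congrArg Prod.fst (finProdFinEquiv.symm_apply_apply x)

theorem modNat_finProdFinEquiv {m n : ℕ} (x : Fin m × Fin n) :
    (finProdFinEquiv x).modNat = x.2 :=
  congrArg Prod.snd (finProdFinEquiv.symm_apply_apply x)

variable (I : QAP R) (M σ τ : R)

/-- The arc that stands for placing facility `i` at location `j`. -/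
def arc (j i : Fin I.n) : Fin (I.toQSPP M σ τ).nA :=
  (finProdFinEquiv (j, i) : Fin (I.n * I.n))

theorem exists_eq_arc (e : Fin (I.toQSPP M σ τ).nA) : ∃ j i, e = I.arc M σ τ j i :=
  ⟨Fin.divNat (m := I.n) (n := I.n) e, Fin.modNat (m := I.n) (n := I.n) e,
    (finProdFinEquiv.apply_symm_apply (e : Fin (I.n * I.n))).symm⟩

theorem arc_injective {j i l k : Fin I.n} :
    I.arc M σ τ j i = I.arc M σ τ l k ↔ j = l ∧ i = k :=
  finProdFinEquiv.injective.eq_iff.trans Prod.mk_inj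

theorem src_arc (j i : Fin I.n) : ((I.toQSPP M σ τ).src (I.arc M σ τ j i) : ℕ) = j :=
  congrArg Fin.val (divNat_finProdFinEquiv (j, i))

theorem tgt_arc (j i : Fin I.n) : ((I.toQSPP M σ τ).tgt (I.arc M σ τ j i) : ℕ) = j + 1 :=
  congrArg (fun j : Fin I.n => (j : ℕ) + 1) (divNat_finProdFinEquiv (j, i))

theorem c_arc (j i : Fin I.n) :
    (I.toQSPP M σ τ).c (I.arc M σ τ j i) = I.C i j + I.A i i * I.B j j + τ := by
  change I.C (finProdFinEquiv (j, i)).modNat (finProdFinEquiv (j, i)).divNat +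
    I.A (finProdFinEquiv (j, i)).modNat (finProdFinEquiv (j, i)).modNat *
    I.B (finProdFinEquiv (j, i)).divNat (finProdFinEquiv (j, i)).divNat + τ = _
  rw [divNat_finProdFinEquiv, modNat_finProdFinEquiv]

theorem Q_arc (j i l k : Fin I.n) :
    (I.toQSPP M σ τ).Q (I.arc M σ τ j i) (I.arc M σ τ l k) =
      if j = l ∧ i = k then 0 else if i = k ∨ j = l then M else I.A i k * I.B j l + σ := by
  change (if (finProdFinEquiv (j, i) : Fin (I.n * I.n)) = finProdFinEquiv (l, k) then (0 : R)
    else if (finProdFinEquiv (j, i)).modNat = (finProdFinEquiv (l, k)).modNat ∨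
      (finProdFinEquiv (j, i)).divNat = (finProdFinEquiv (l, k)).divNat then M
    else I.A (finProdFinEquiv (j, i)).modNat (finProdFinEquiv (l, k)).modNat *
      I.B (finProdFinEquiv (j, i)).divNat (finProdFinEquiv (l, k)).divNat + σ) = _
  simp only [divNat_finProdFinEquiv, modNat_finProdFinEquiv, EmbeddingLike.apply_eq_iff_eq,
    Prod.mk.injEq]

theorem toQSPP_tgt (e : Fin (I.toQSPP M σ τ).nA) :
    ((I.toQSPP M σ τ).tgt e : ℕ) = (I.toQSPP M σ τ).src e + 1 := by
  obtain ⟨j, i, rfl⟩ := I.exists_eq_arc M σ τ e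
  rw [src_arc, tgt_arc]

/-- The arc sequence that serves the locations in order, location `j` by the facility `g j`. -/
def choicePath (g : Fin I.n → Fin I.n) : List (Fin (I.toQSPP M σ τ).nA) :=
  List.ofFn fun j => I.arc M σ τ j (g j)

theorem arcPath_eq_choicePath (π : Equiv.Perm (Fin I.n)) :
    arcPath π = I.choicePath M σ τ π.symm := rfl

theorem choicePath_injective : Function.Injective (I.choicePath M σ τ) := by
  intro g g' h
  funext j
  exact ((I.arc_injective M σ τ).1 (congrFun (List.ofFn_injective h) j)).2

theorem isPath_toQSPP_choicePath (g : Fin I.n → Fin I.n) :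
    (I.toQSPP M σ τ).IsPath (I.choicePath M σ τ g) := by
  refine ⟨?_, ?_, ?_⟩
  · intro h
    have := congrArg List.length h
    rw [choicePath, List.length_ofFn] at this
    exact I.n_pos.ne' this
  · exact QSPP.isWalk_drop_ofFn _ (fun j => I.src_arc M σ τ j (g j))
      (fun j => I.tgt_arc M σ τ j (g j)) (k := 0) I.n.zero_le rfl rfl
  · refine List.Nodup.of_map Fin.val ?_
    -- The vertices visited are `0, …, n` in this order.
    have : ((I.toQSPP M σ τ).s :: (I.choicePath M σ τ g).map (I.toQSPP M σ τ).tgt).map Fin.val =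
        List.ofFn (Fin.val : Fin (I.n + 1) → ℕ) := by
      rw [List.ofFn_succ, choicePath, List.map_cons, List.map_ofFn, List.map_ofFn]
      simp only [Function.comp_def, tgt_arc, Fin.val_succ]
      rfl
    rw [this]
    exact List.nodup_ofFn.2 Fin.val_injective

theorem isPath_toQSPP_arcPath (π : Equiv.Perm (Fin I.n)) :
    (I.toQSPP M σ τ).IsPath (arcPath π) :=
  I.isPath_toQSPP_choicePath M σ τ π.symm

/-- The layer grows by one along each arc, so the path has `n` arcs and the one at position `j`
leaves layer `j`. Only its facility remains free. -/
theorem exists_choicePath_of_isPath {P : List (Fin (I.toQSPP M σ τ).nA)}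
    (hP : (I.toQSPP M σ τ).IsPath P) : ∃ g, P = I.choicePath M σ τ g := by
  obtain ⟨-, hw, -⟩ := hP
  have hlen : P.length = I.n := by
    have : I.n = 0 + P.length := hw.val_eq_add_length (toQSPP_tgt I M σ τ)
    omega
  have hsrc : P.map (fun e => ((I.toQSPP M σ τ).src e : ℕ)) = List.range' 0 P.length :=
    hw.map_src_eq_range' (toQSPP_tgt I M σ τ)
  have : ∀ j : Fin I.n, ∃ i, P[(j : ℕ)]'(by rw [hlen]; exact j.2) = I.arc M σ τ j i := by
    intro j
    obtain ⟨j', i, h⟩ := I.exists_eq_arc M σ τ (P[(j : ℕ)]'(by rw [hlen]; exact j.2))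
    have hj := List.getElem_of_eq hsrc (i := j) (by rw [List.length_map, hlen]; exact j.2)
    rw [List.getElem_map, h, src_arc, List.getElem_range'] at hj
    obtain rfl : j' = j := Fin.ext (by omega)
    exact ⟨i, h⟩
  choose g hg using this
  refine ⟨g, List.ext_getElem (by rw [choicePath, List.length_ofFn, hlen]) fun j h₁ h₂ => ?_⟩
  simp only [choicePath, List.getElem_ofFn]
  exact hg ⟨j, hlen ▸ h₁⟩

theorem cost_toQSPP_choicePath (g : Fin I.n → Fin I.n) :
    (I.toQSPP M σ τ).cost (I.choicePath M σ τ g) =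
      (∑ j, ∑ l, (I.toQSPP M σ τ).Q (I.arc M σ τ j (g j)) (I.arc M σ τ l (g l))) +
        ∑ j, (I.toQSPP M σ τ).c (I.arc M σ τ j (g j)) := by
  simp only [QSPP.cost, choicePath, List.map_ofFn, List.sum_ofFn, Function.comp_def]

/-- The interaction cost of placing facilities `i` and `k` at locations `j` and `l`, with the pairs
that are not part of an assignment left out. -/
def pairCost (i k j l : Fin I.n) : R :=
  if i = k then 0 else if j = l then 0 else I.A i k * I.B j l + σ

/-- Paths are indexed by locations, assignments by facilities; the substitution `j = π i` passes
between them. `M` disappears because distinct facilities have distinct locations. -/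
theorem cost_toQSPP_arcPath (π : Equiv.Perm (Fin I.n)) :
    (I.toQSPP M σ τ).cost (arcPath π) =
      (∑ i, ∑ k, I.pairCost σ i k (π i) (π k)) +
        ∑ i, (I.C i (π i) + I.A i i * I.B (π i) (π i) + τ) := by
  rw [I.arcPath_eq_choicePath M σ τ, cost_toQSPP_choicePath,
    ← Equiv.sum_comp π (fun j => ∑ l, _), ← Equiv.sum_comp π (fun j => (I.toQSPP M σ τ).c _)]
  congr 1
  · refine Finset.sum_congr rfl fun i _ => ?_
    rw [← Equiv.sum_comp π (fun l => (I.toQSPP M σ τ).Q _ _)]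
    refine Finset.sum_congr rfl fun k _ => ?_
    by_cases h : i = k <;> simp [Q_arc, pairCost, h]
  · simp [c_arc]

theorem cost_toQSPP_arcPath_eq (π : Equiv.Perm (Fin I.n)) :
    (I.toQSPP M σ τ).cost (arcPath π) = I.cost π + I.offset σ τ := by
  -- The sum over distinct pairs is the full sum minus its diagonal; the linear costs pay the
  -- diagonal products back, and `σ` survives `n * n - n` times.
  have h : ∀ i k, I.pairCost σ i k (π i) (π k) =
      (I.A i k * I.B (π i) (π k) + σ) -
        if i = k then I.A i k * I.B (π i) (π k) + σ else 0 := by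
    intro i k
    by_cases h : i = k <;> simp [pairCost, h]
  simp only [cost_toQSPP_arcPath, h, cost_eq, Finset.sum_sub_distrib, Finset.sum_add_distrib,
    Finset.sum_ite_eq, Finset.mem_univ, if_true, Finset.sum_const, Finset.card_univ,
    Fintype.card_fin, nsmul_eq_mul, offset]
  ring

end Ring

/-! ### Choice of the parameters and correctness of the reduction -/

section Ordered

variable {R : Type} [CommRing R] [LinearOrder R] (I : QAP R)

/-- A shift that makes all interaction costs nonnegative. -/
def pairShift : R :=
  ∑ i, ∑ k, ∑ j, ∑ l, if i = k then 0 else if j = l then 0 else max (-(I.A i k * I.B j l)) 0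

/-- A shift that makes all linear costs nonnegative. -/
def arcShift : R := ∑ i, ∑ j, max (-(I.C i j + I.A i i * I.B j j)) 0

/-- A penalty that exceeds the costs of all assignments after shifting. -/
def penalty : R :=
  1 + ∑ i, ∑ j, (I.C i j + I.A i i * I.B j j + I.arcShift) +
    ∑ i, ∑ k, ∑ j, ∑ l, I.pairCost I.pairShift i k j l

variable [IsStrictOrderedRing R]

/-- A sum of negative parts dominates each of them. -/
theorem arcCost_nonneg (i j : Fin I.n) : 0 ≤ I.C i j + I.A i i * I.B j j + I.arcShift := by
  have h₁ : ∀ i' j', 0 ≤ max (-(I.C i' j' + I.A i' i' * I.B j' j')) 0 := fun _ _ => le_max_right _ _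
  have h : max (-(I.C i j + I.A i i * I.B j j)) 0 ≤ I.arcShift :=
    (Finset.single_le_sum (f := fun j => max (-(I.C i j + I.A i i * I.B j j)) 0)
      (fun j _ => h₁ i j) (Finset.mem_univ j)).trans
    (Finset.single_le_sum (f := fun i => ∑ j, max (-(I.C i j + I.A i i * I.B j j)) 0)
      (fun i _ => Finset.sum_nonneg fun j _ => h₁ i j) (Finset.mem_univ i))
  linarith [le_max_left (-(I.C i j + I.A i i * I.B j j)) 0]

theorem le_sum_four {n : ℕ} {F : Fin n → Fin n → Fin n → Fin n → R}
    (hF : ∀ i k j l, 0 ≤ F i k j l) (i k j l : Fin n) :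
    F i k j l ≤ ∑ i, ∑ k, ∑ j, ∑ l, F i k j l :=
  calc F i k j l ≤ ∑ l, F i k j l :=
        Finset.single_le_sum (f := fun l => F i k j l) (fun l _ => hF i k j l) (Finset.mem_univ l)
    _ ≤ ∑ j, ∑ l, F i k j l :=
        Finset.single_le_sum (f := fun j => ∑ l, F i k j l)
          (fun j _ => Finset.sum_nonneg fun l _ => hF i k j l) (Finset.mem_univ j)
    _ ≤ ∑ k, ∑ j, ∑ l, F i k j l :=
        Finset.single_le_sum (f := fun k => ∑ j, ∑ l, F i k j l)
          (fun k _ => Finset.sum_nonneg fun j _ => Finset.sum_nonneg fun l _ => hF i k j l)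
          (Finset.mem_univ k)
    _ ≤ ∑ i, ∑ k, ∑ j, ∑ l, F i k j l :=
        Finset.single_le_sum (f := fun i => ∑ k, ∑ j, ∑ l, F i k j l)
          (fun i _ => Finset.sum_nonneg fun k _ => Finset.sum_nonneg fun j _ =>
            Finset.sum_nonneg fun l _ => hF i k j l) (Finset.mem_univ i)

theorem interaction_nonneg {i k j l : Fin I.n} (hik : i ≠ k) (hjl : j ≠ l) :
    0 ≤ I.A i k * I.B j l + I.pairShift := by
  have h := le_sum_four (F := fun i k j l =>
    if i = k then 0 else if j = l then 0 else max (-(I.A i k * I.B j l)) 0)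
    (fun i k j l => by split_ifs <;> simp) i k j l
  simp only [hik, hjl, if_false] at h
  have h' : max (-(I.A i k * I.B j l)) 0 ≤ I.pairShift := h
  linarith [le_max_left (-(I.A i k * I.B j l)) 0]

theorem pairCost_nonneg (i k j l : Fin I.n) : 0 ≤ I.pairCost I.pairShift i k j l := by
  unfold pairCost
  split_ifs with h₁ h₂
  · exact le_rfl
  · exact le_rfl
  · exact I.interaction_nonneg h₁ h₂

theorem penalty_nonneg : 0 ≤ I.penalty := by
  have h₁ : 0 ≤ ∑ i, ∑ j, (I.C i j + I.A i i * I.B j j + I.arcShift) :=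
    Finset.sum_nonneg fun i _ => Finset.sum_nonneg fun j _ => I.arcCost_nonneg i j
  have h₂ : 0 ≤ ∑ i, ∑ k, ∑ j, ∑ l, I.pairCost I.pairShift i k j l :=
    Finset.sum_nonneg fun i _ => Finset.sum_nonneg fun k _ => Finset.sum_nonneg fun j _ =>
      Finset.sum_nonneg fun l _ => I.pairCost_nonneg i k j l
  unfold penalty
  linarith

theorem shifts_eq_zero (h : I.NonnegCosts) : I.pairShift = 0 ∧ I.arcShift = 0 := by
  constructor
  · refine Finset.sum_eq_zero fun i _ => Finset.sum_eq_zero fun k _ => Finset.sum_eq_zero fun j _ =>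
      Finset.sum_eq_zero fun l _ => ?_
    split_ifs with h₁ h₂
    · rfl
    · rfl
    · exact max_eq_right (neg_nonpos.2 (h.2 i j k l h₁ h₂))
  · exact Finset.sum_eq_zero fun i _ => Finset.sum_eq_zero fun j _ =>
      max_eq_right (neg_nonpos.2 (h.1 i j))

/-- The instance of the quadratic shortest path problem with the default parameters. -/
abbrev reduction : QSPP R := I.toQSPP I.penalty I.pairShift I.arcShift

theorem valid_reduction : I.reduction.Valid where
  c_nonneg e := by
    obtain ⟨j, i, rfl⟩ := I.exists_eq_arc _ _ _ e
    rw [c_arc]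
    exact I.arcCost_nonneg i j
  Q_nonneg e f := by
    obtain ⟨j, i, rfl⟩ := I.exists_eq_arc _ _ _ e
    obtain ⟨l, k, rfl⟩ := I.exists_eq_arc _ _ _ f
    rw [Q_arc]
    split_ifs with h₁ h₂
    · exact le_rfl
    · exact I.penalty_nonneg
    · rw [not_or] at h₂
      exact I.interaction_nonneg h₂.1 h₂.2
  Q_symm := by
    refine Matrix.IsSymm.ext fun e f => ?_
    obtain ⟨j, i, rfl⟩ := I.exists_eq_arc _ _ _ e
    obtain ⟨l, k, rfl⟩ := I.exists_eq_arc _ _ _ f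
    rw [Q_arc, Q_arc, I.A_symm.apply, I.B_symm.apply]
    simp only [eq_comm (a := l), eq_comm (a := k)]
  Q_diag e := by
    obtain ⟨j, i, rfl⟩ := I.exists_eq_arc _ _ _ e
    rw [Q_arc, if_pos ⟨rfl, rfl⟩]
  no_zero_cycle P hP := by
    obtain ⟨hne, ⟨u, hu⟩, -⟩ := hP
    -- A closed walk ends in the layer in which it starts, so it has length zero.
    have := hu.val_eq_add_length (toQSPP_tgt I _ _ _)
    exact absurd (List.length_eq_zero_iff.1 (by omega)) hne

/-- The costs that `π` incurs are some of the nonnegative terms summed in `penalty`; the extra `1`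
there makes the inequality strict. -/
theorem cost_arcPath_lt_penalty (π : Equiv.Perm (Fin I.n)) :
    I.reduction.cost (arcPath π) < I.penalty := by
  have h₁ : ∑ i, (I.C i (π i) + I.A i i * I.B (π i) (π i) + I.arcShift) ≤
      ∑ i, ∑ j, (I.C i j + I.A i i * I.B j j + I.arcShift) :=
    Finset.sum_le_sum fun i _ =>
      Finset.single_le_sum (f := fun j => I.C i j + I.A i i * I.B j j + I.arcShift)
        (fun j _ => I.arcCost_nonneg i j) (Finset.mem_univ (π i))
  have h₂ : ∑ i, ∑ k, I.pairCost I.pairShift i k (π i) (π k) ≤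
      ∑ i, ∑ k, ∑ j, ∑ l, I.pairCost I.pairShift i k j l :=
    Finset.sum_le_sum fun i _ => Finset.sum_le_sum fun k _ =>
      (Finset.single_le_sum (f := fun l => I.pairCost I.pairShift i k (π i) l)
        (fun l _ => I.pairCost_nonneg i k (π i) l) (Finset.mem_univ (π k))).trans
      (Finset.single_le_sum (f := fun j => ∑ l, I.pairCost I.pairShift i k j l)
        (fun j _ => Finset.sum_nonneg fun l _ => I.pairCost_nonneg i k j l)
        (Finset.mem_univ (π i)))
  rw [cost_toQSPP_arcPath, penalty]
  linarith

/-- Two locations served by the same facility already cost `penalty`, and nothing else on the path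
is negative. -/
theorem penalty_le_cost_choicePath {g : Fin I.n → Fin I.n} (hg : ¬ Function.Injective g) :
    I.penalty ≤ I.reduction.cost (I.choicePath _ _ _ g) := by
  obtain ⟨j, l, hgjl, hjl⟩ : ∃ j l, g j = g l ∧ j ≠ l := by
    simpa [Function.Injective] using hg
  have hv := I.valid_reduction
  let a (j : Fin I.n) := I.arc I.penalty I.pairShift I.arcShift j (g j)
  have hQ : I.reduction.Q (a j) (a l) = I.penalty := by
    simp [a, Q_arc, hgjl, hjl]
  have h₁ : I.penalty ≤ ∑ j, ∑ l, I.reduction.Q (a j) (a l) := by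
    rw [← hQ]
    exact (Finset.single_le_sum (f := fun l => I.reduction.Q (a j) (a l))
      (fun l _ => hv.Q_nonneg _ _) (Finset.mem_univ l)).trans
      (Finset.single_le_sum (f := fun j => ∑ l, I.reduction.Q (a j) (a l))
        (fun j _ => Finset.sum_nonneg fun l _ => hv.Q_nonneg _ _) (Finset.mem_univ j))
  have h₂ : 0 ≤ ∑ j, I.reduction.c (a j) := Finset.sum_nonneg fun j _ => hv.c_nonneg _
  rw [cost_toQSPP_choicePath]
  exact h₁.trans (le_add_of_nonneg_right h₂)

theorem existsUnique_arcPath {P : List (Fin I.reduction.nA)} (hP : I.reduction.IsPath P)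
    (hc : I.reduction.cost P < I.penalty) : ∃! π : Equiv.Perm (Fin I.n), P = arcPath π := by
  obtain ⟨g, rfl⟩ := exists_choicePath_of_isPath I _ _ _ hP
  have hg : Function.Injective g := by
    by_contra hg
    exact (I.penalty_le_cost_choicePath hg).not_gt hc
  -- `g` sends locations to facilities and an assignment goes the other way, whence the inverse.
  refine ⟨(Equiv.ofBijective g (Finite.injective_iff_bijective.1 hg)).symm, rfl, fun π hπ => ?_⟩
  have : g = π.symm := I.choicePath_injective _ _ _ hπ
  ext i
  subst this
  congr 1
  rw [Equiv.eq_symm_apply]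
  simp

/-- Every path costs at least as much as the path of some assignment. -/
theorem exists_arcPath_cost_le {P : List (Fin I.reduction.nA)} (hP : I.reduction.IsPath P) :
    ∃ π : Equiv.Perm (Fin I.n), I.reduction.cost (arcPath π) ≤ I.reduction.cost P := by
  rcases lt_or_ge (I.reduction.cost P) I.penalty with h | h
  · obtain ⟨π, rfl, -⟩ := I.existsUnique_arcPath hP h
    exact ⟨π, le_rfl⟩
  -- A path that costs at least `penalty` is beaten by every assignment, for instance by the
  -- identity.
  · exact ⟨1, (I.cost_arcPath_lt_penalty 1).le.trans h⟩

theorem exists_cost_le_iff (v : R) :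
    (∃ π : Equiv.Perm (Fin I.n), I.cost π ≤ v) ↔
      ∃ P, I.reduction.IsPath P ∧ I.reduction.cost P ≤ v + I.offset I.pairShift I.arcShift := by
  constructor
  · rintro ⟨π, hπ⟩
    refine ⟨arcPath π, I.isPath_toQSPP_arcPath _ _ _ π, ?_⟩
    rw [cost_toQSPP_arcPath_eq]
    gcongr
  · rintro ⟨P, hP, hv⟩
    obtain ⟨π, hπ⟩ := I.exists_arcPath_cost_le hP
    rw [cost_toQSPP_arcPath_eq] at hπ
    exact ⟨π, by simpa using hπ.trans hv⟩

theorem isLeast_cost_iff (v : R) :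
    IsLeast {x | ∃ π : Equiv.Perm (Fin I.n), x = I.cost π} v ↔
      IsLeast {x | ∃ P, I.reduction.IsPath P ∧ x = I.reduction.cost P}
        (v + I.offset I.pairShift I.arcShift) := by
  constructor
  · rintro ⟨⟨π, rfl⟩, hmin⟩
    refine ⟨⟨arcPath π, I.isPath_toQSPP_arcPath _ _ _ π, (cost_toQSPP_arcPath_eq I _ _ _ π).symm⟩, ?_⟩
    rintro _ ⟨P, hP, rfl⟩
    obtain ⟨ρ, hρ⟩ := I.exists_arcPath_cost_le hP
    refine le_trans ?_ hρ
    rw [cost_toQSPP_arcPath_eq]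
    gcongr
    exact hmin ⟨ρ, rfl⟩
  · rintro ⟨⟨P, hP, hv⟩, hmin⟩
    have hlow : ∀ π, v ≤ I.cost π := fun π => by
      have := hmin ⟨arcPath π, I.isPath_toQSPP_arcPath _ _ _ π, rfl⟩
      rw [cost_toQSPP_arcPath_eq] at this
      simpa using this
    obtain ⟨π, hπ⟩ := I.exists_arcPath_cost_le hP
    rw [← hv, cost_toQSPP_arcPath_eq] at hπ
    refine ⟨⟨π, (hlow π).antisymm (by simpa using hπ)⟩, ?_⟩
    rintro _ ⟨ρ, rfl⟩
    exact hlow ρ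

theorem reducesWith : I.ReducesWith I.penalty I.pairShift I.arcShift where
  valid := I.valid_reduction
  no_shift := I.shifts_eq_zero
  isPath_arcPath := I.isPath_toQSPP_arcPath _ _ _
  cost_arcPath := cost_toQSPP_arcPath_eq I _ _ _
  cost_arcPath_lt := I.cost_arcPath_lt_penalty
  eq_arcPath_of_cost_lt _ := I.existsUnique_arcPath
  optimal_value := I.isLeast_cost_iff

end Ordered

end QAP

namespace RAM

/-! ### Bit lengths -/

@[simp]
theorem bits_zero : bits 0 = 0 := rfl

@[simp]
theorem bits_one : bits 1 = 1 := rfl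

theorem natAbs_lt_two_pow_bits (a : ℤ) : a.natAbs < 2 ^ bits a := Nat.lt_size_self _

theorem bits_le_of_natAbs_le {a b c : ℤ} (h : c.natAbs ≤ a.natAbs + b.natAbs) :
    bits c ≤ bits a + bits b + 1 := by
  have h₁ : 2 ^ bits a ≤ 2 ^ (bits a + bits b) := Nat.pow_le_pow_right two_pos (by omega)
  have h₂ : 2 ^ bits b ≤ 2 ^ (bits a + bits b) := Nat.pow_le_pow_right two_pos (by omega)
  have ha := natAbs_lt_two_pow_bits a
  have hb := natAbs_lt_two_pow_bits b
  refine Nat.size_le.2 ?_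
  rw [pow_succ]
  omega

theorem bits_add_le (a b : ℤ) : bits (a + b) ≤ bits a + bits b + 1 :=
  bits_le_of_natAbs_le (Int.natAbs_add_le a b)

theorem bits_sub_le (a b : ℤ) : bits (a - b) ≤ bits a + bits b + 1 :=
  bits_le_of_natAbs_le (Int.natAbs_sub_le a b)

/-- The summand `1` is not needed for products; it gives all operations of `BinOp` the same bound.
-/
theorem bits_mul_le (a b : ℤ) : bits (a * b) ≤ bits a + bits b + 1 := by
  refine (Nat.size_le.2 ?_).trans (Nat.le_succ _)
  rw [Int.natAbs_mul, pow_add]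
  exact Nat.mul_lt_mul'' (natAbs_lt_two_pow_bits a) (natAbs_lt_two_pow_bits b)

theorem bits_natCast_le (n : ℕ) : bits n ≤ n :=
  Nat.size_le.2 (by simpa using Nat.lt_two_pow_self)

theorem length_le_bitLength (l : List ℤ) : l.length ≤ bitLength l := by
  induction l with
  | nil => simp
  | cons a l ih =>
    simp only [bitLength, List.map_cons, List.sum_cons, List.length_cons] at ih ⊢
    omega

theorem bits_getD_le_bitLength (l : List ℤ) (i : ℕ) : bits (l.getD i 0) ≤ bitLength l := by
  induction l generalizing i with
  | nil => simp
  | cons a l ih =>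
    have h : bitLength (a :: l) = bits a + 1 + bitLength l := by simp [bitLength]
    cases i with
    | zero => simp only [List.getD_cons_zero]; omega
    | succ i =>
      have := ih i
      simp only [List.getD_cons_succ]
      omega

/-! ### States -/

@[simp]
theorem State.set_out (S : State) (i : ℕ) (z : ℤ) : (S.set i z).out = S.out := rfl

@[simp]
theorem State.set_reg_self (S : State) (i : ℕ) (z : ℤ) : (S.set i z).reg i = z :=
  Function.update_self ..

theorem State.set_reg_of_ne (S : State) {i j : ℕ} (z : ℤ) (h : j ≠ i) :
    (S.set i z).reg j = S.reg j :=
  Function.update_of_ne h ..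

/-- A binary operation of the machine. -/
structure BinOp where
  op : ℤ → ℤ → ℤ
  instr : ℕ → ℕ → ℕ → Instr
  step_eq : ∀ l S i j k, (instr i j k).step l S = S.set i (op (S.reg j) (S.reg k))
  cost_eq : ∀ l S i j k, (instr i j k).cost l S = 1 + bits (S.reg j) + bits (S.reg k)
  bits_le : ∀ a b, bits (op a b) ≤ bits a + bits b + 1

def addOp : BinOp := ⟨(· + ·), .add, fun _ _ _ _ _ => rfl, fun _ _ _ _ _ => rfl, bits_add_le⟩

def subOp : BinOp := ⟨(· - ·), .sub, fun _ _ _ _ _ => rfl, fun _ _ _ _ _ => rfl, bits_sub_le⟩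

def mulOp : BinOp := ⟨(· * ·), .mul, fun _ _ _ _ _ => rfl, fun _ _ _ _ _ => rfl, bits_mul_le⟩

/-! ### Counted loops -/

/-- The counter never exceeds `n`, so each test costs at most `1 + n`; the last summand pays for the
failing test. -/
theorem exec_loop {l : List ℤ} {p : Prog} {m n B : ℕ} {Inv : ℕ → State → Prop}
    (body : ∀ a < n, ∀ S, Inv a S → S.reg m = ((n - a : ℕ) : ℤ) →
      ∃ T c, Exec l p S T c ∧ c ≤ B ∧ Inv (a + 1) T ∧ T.reg m = ((n - (a + 1) : ℕ) : ℤ))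
    {a : ℕ} (ha : a ≤ n) {S : State} (hS : Inv a S) (hm : S.reg m = ((n - a : ℕ) : ℤ)) :
    ∃ T c, Exec l (.loop m p) S T c ∧ Inv n T ∧ c ≤ (n - a) * (1 + n + B) + (1 + n) := by
  have hbits : bits (S.reg m) ≤ n := by
    rw [hm]
    exact (bits_natCast_le _).trans (Nat.sub_le _ _)
  induction hd : n - a generalizing a S with
  | zero =>
    obtain rfl : a = n := by omega
    exact ⟨S, _, .loop_neg (by rw [hm]; simp), hS, by omega⟩
  | succ d ih =>
    have hlt : a < n := by omega
    obtain ⟨T, c, hT, hc, hInv, hTm⟩ := body a hlt S hS hm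
    obtain ⟨U, c', hU, hInv', hc'⟩ := ih hlt hInv hTm
      (by rw [hTm]; exact (bits_natCast_le _).trans (Nat.sub_le _ _)) (by omega)
    refine ⟨U, _, .loop_pos (by rw [hm, hd]; positivity) hT hU, hInv', ?_⟩
    rw [add_mul, one_mul]
    omega

/-- Repeat `p` for the values `0, …, n - 1` of register `m`, where `n` is the first input number.
Register `m + 1` counts the remaining passes. -/
def forProg (m : ℕ) (p : Prog) : Prog :=
  .seq (.instr (.const m 0)) (.seq (.instr (.read (m + 1) m)) (.loop (m + 1)
    (.seq p (.seq (.instr (.const (m + 2) 1)) (.seq (.instr (.add m m (m + 2)))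
      (.instr (.sub (m + 1) (m + 1) (m + 2))))))))

/-- `hInv` requires that the invariant see only the output and the registers below `m`, so the
bookkeeping of the loop cannot destroy it. -/
theorem exec_forProg {l : List ℤ} {p : Prog} {m n B : ℕ} {Inv : ℕ → State → Prop}
    (hn : l.getD 0 0 = n)
    (hInv : ∀ a S T, T.out = S.out → (∀ i < m, T.reg i = S.reg i) → Inv a S → Inv a T)
    (body : ∀ a < n, ∀ S, Inv a S → S.reg m = (a : ℤ) →
      ∃ T c, Exec l p S T c ∧ c ≤ B ∧ Inv (a + 1) T ∧ T.reg m = S.reg m ∧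
        T.reg (m + 1) = S.reg (m + 1))
    {S : State} (hS : Inv 0 S) :
    ∃ T c, Exec l (forProg m p) S T c ∧ Inv n T ∧ c ≤ n * (7 + 3 * n + B) + (3 + 2 * n) := by
  -- The three bookkeeping instructions cost at most `2`, `2 + n` and `2 + n`.
  have hloop : ∀ a < n, ∀ S, (Inv a S ∧ S.reg m = (a : ℤ)) → S.reg (m + 1) = ((n - a : ℕ) : ℤ) →
      ∃ T c, Exec l (.seq p (.seq (.instr (.const (m + 2) 1)) (.seq (.instr (.add m m (m + 2)))
        (.instr (.sub (m + 1) (m + 1) (m + 2)))))) S T c ∧ c ≤ B + (6 + 2 * n) ∧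
        (Inv (a + 1) T ∧ T.reg m = ((a + 1 : ℕ) : ℤ)) ∧
        T.reg (m + 1) = ((n - (a + 1) : ℕ) : ℤ) := by
    rintro a ha S ⟨hSa, hSm⟩ hSm'
    obtain ⟨T, c, hT, hc, hTa, hTm, hTm'⟩ := body a ha S hSa hSm
    rw [hSm] at hTm
    rw [hSm'] at hTm'
    refine ⟨_, _, .seq hT (.seq (.instr _ _) (.seq (.instr _ _) (.instr _ _))), ?_,
      ⟨hInv _ T _ ?_ ?_ hTa, ?_⟩, ?_⟩
    · have h₁ : bits (a : ℤ) ≤ n := (bits_natCast_le a).trans ha.le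
      have h₂ : bits ((n - a : ℕ) : ℤ) ≤ n := (bits_natCast_le _).trans (Nat.sub_le _ _)
      simp only [Instr.step, Instr.cost, bits_one, State.set_reg_self,
        State.set_reg_of_ne _ _ (show m ≠ m + 2 by omega),
        State.set_reg_of_ne _ _ (show m + 1 ≠ m by omega),
        State.set_reg_of_ne _ _ (show m + 2 ≠ m by omega),
        State.set_reg_of_ne _ _ (show m + 1 ≠ m + 2 by omega), hTm, hTm']
      omega
    · simp [Instr.step]
    · intro i hi
      simp only [Instr.step]
      rw [State.set_reg_of_ne _ _ (by omega), State.set_reg_of_ne _ _ (by omega),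
        State.set_reg_of_ne _ _ (by omega)]
    · simp only [Instr.step, State.set_reg_self,
        State.set_reg_of_ne _ _ (show m ≠ m + 2 by omega),
        State.set_reg_of_ne _ _ (show m ≠ m + 1 by omega), hTm]
      push_cast
      ring
    · simp only [Instr.step, State.set_reg_self,
        State.set_reg_of_ne _ _ (show m + 1 ≠ m by omega),
        State.set_reg_of_ne _ _ (show m + 2 ≠ m by omega),
        State.set_reg_of_ne _ _ (show m + 1 ≠ m + 2 by omega), hTm']
      omega
  obtain ⟨T, c, hT, ⟨hTn, -⟩, hc⟩ := exec_loop hloop n.zero_le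
    (S := (S.set m 0).set (m + 1) n)
    ⟨hInv _ S _ rfl (fun i hi => by
      rw [State.set_reg_of_ne _ _ (by omega), State.set_reg_of_ne _ _ (by omega)]) hS, by
      rw [State.set_reg_of_ne _ _ (by omega), State.set_reg_self, Nat.cast_zero]⟩ (by simp)
  have hstep : (Instr.read (m + 1) m).step l ((Instr.const m 0).step l S) =
      (S.set m 0).set (m + 1) n := by
    simp only [Instr.step, State.set_reg_self, Int.toNat_zero, hn]
  rw [← hstep] at hT
  refine ⟨T, _, .seq (.instr _ _) (.seq (.instr _ _) hT), hTn, ?_⟩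
  · have h₂ : bits (n : ℤ) ≤ n := bits_natCast_le n
    have h : n * (1 + n + (B + (6 + 2 * n))) = n * (7 + 3 * n + B) := by ring
    simp only [Instr.cost, Instr.step, State.set_reg_self, bits_zero, Int.toNat_zero, hn]
    rw [Nat.sub_zero, h] at hc
    omega

end RAM

/-! ### Functions of a coded instance -/

namespace QAP

/-- A quadratic assignment instance with a threshold, together with a code for them. -/
structure Code where
  x : QAP ℚ × ℚ
  word : List ℤ
  enc : QAP.Enc x word

namespace Code

abbrev n (y : Code) : ℕ := y.x.1.n

/-- The length of the code in bits. -/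
abbrev size (y : Code) : ℕ := RAM.bitLength y.word

theorem word_getD_zero (y : Code) : y.word.getD 0 0 = (y.n : ℤ) := by
  obtain ⟨l', h, -⟩ := y.enc
  rw [h, List.getD_cons_zero]

end Code

end QAP

/-! ### Positions of the numbers in a code -/

namespace RAM

open QAP (Code)

theorem EncRats.length_eq {qs : List ℚ} {l : List ℤ} (h : EncRats qs l) :
    l.length = 2 * qs.length := by
  induction h with
  | nil => rfl
  | cons _ _ _ ih => simp only [List.length_cons, ih]; ring

theorem EncRats.getD {qs : List ℚ} {l : List ℤ} (h : EncRats qs l) {p : ℕ} {q : ℚ}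
    (hq : qs[p]? = some q) :
    0 < l.getD (2 * p + 1) 0 ∧ q = (l.getD (2 * p) 0 : ℚ) / (l.getD (2 * p + 1) 0 : ℚ) := by
  induction h generalizing p with
  | nil => simp at hq
  | cons hden hval _ ih =>
    cases p with
    | zero =>
      obtain rfl := Option.some.inj hq
      exact ⟨hden, hval⟩
    | succ p => exact ih hq

theorem EncRats.append {qs qs' : List ℚ} {l l' : List ℤ} (h : EncRats qs l) (h' : EncRats qs' l') :
    EncRats (qs ++ qs') (l ++ l') := by
  induction h with
  | nil => exact h'
  | cons hden hval _ ih => exact .cons hden hval ih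

theorem EncRats.flatten_ofFn {n : ℕ} {qs : Fin n → List ℚ} {l : Fin n → List ℤ}
    (h : ∀ a, EncRats (qs a) (l a)) : EncRats (List.ofFn qs).flatten (List.ofFn l).flatten := by
  induction n with
  | zero => exact .nil
  | succ n ih =>
    simp only [List.ofFn_succ, List.flatten_cons]
    exact (h 0).append (ih fun a => h a.succ)

theorem rows_eq_ofFn {m n : ℕ} (A : Matrix (Fin m) (Fin n) ℚ) :
    rows A = List.ofFn fun e : Fin (m * n) => A e.divNat e.modNat := by
  rw [List.ofFn_mul, rows]
  congr 2
  funext i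
  congr 1
  funext j
  congr 1
  · exact (congrArg Prod.fst (finProdFinEquiv.symm_apply_apply (i, j))).symm.trans
      (congrArg Fin.divNat (Fin.ext (by simp [finProdFinEquiv]; ring)))
  · exact (congrArg Prod.snd (finProdFinEquiv.symm_apply_apply (i, j))).symm.trans
      (congrArg Fin.modNat (Fin.ext (by simp [finProdFinEquiv]; ring)))

theorem length_rows {m n : ℕ} (A : Matrix (Fin m) (Fin n) ℚ) : (rows A).length = m * n := by
  rw [rows_eq_ofFn, List.length_ofFn]

theorem rows_getElem? {m n : ℕ} (A : Matrix (Fin m) (Fin n) ℚ) (i : Fin m) (j : Fin n) :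
    (rows A)[(i : ℕ) * n + j]? = some (A i j) := by
  have h : (finProdFinEquiv (i, j) : Fin (m * n)).val = (i : ℕ) * n + j := by
    simp [finProdFinEquiv]; ring
  rw [rows_eq_ofFn, ← h, List.getElem?_ofFn, dif_pos (finProdFinEquiv (i, j)).2]
  simp only [Fin.eta]
  rw [QAP.divNat_finProdFinEquiv, QAP.modNat_finProdFinEquiv]

/-- The rational numbers of an instance with a threshold, in the order in which they are coded. -/
def entries (x : QAP ℚ × ℚ) : List ℚ := rows x.1.A ++ rows x.1.B ++ rows x.1.C ++ [x.2]

/-- The code lists `n * n` entries for each of three matrices. Thus bounds polynomial in the value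
of `n`, not just in its bit length, are admissible. -/
theorem Code.n_le_size (y : Code) : y.n ≤ y.size := by
  obtain ⟨l', h, h'⟩ := y.enc
  have hlen := h'.length_eq
  simp only [List.length_append, length_rows, List.length_cons, List.length_nil] at hlen
  have h₁ := length_le_bitLength y.word
  rw [h, List.length_cons, hlen, ← h] at h₁
  have h₂ : y.n ≤ y.n * y.n := Nat.le_mul_self _
  have h₃ : y.n * y.n ≤ y.size := by
    change 2 * (y.n * y.n + y.n * y.n + y.n * y.n + (0 + 1)) + 1 ≤ y.size at h₁
    omega
  exact h₂.trans h₃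

end RAM

/-! ### Integer functions computable in polynomial time -/

namespace RAM

open QAP (Code)

open Polynomial (X)

/-- An integer that depends on a coded instance and on `k` indices can be computed in polynomial
time, wherever the indices are stored.  The program puts the result into register `m` and changes
no lower register. -/
def IntComputable {k : ℕ} (f : (y : Code) → (Fin k → Fin y.n) → ℤ) : Prop :=
  (∃ b : Polynomial ℕ, ∀ y r, bits (f y r) ≤ b.eval y.size) ∧
    ∀ (loc : Fin k → ℕ) (m : ℕ), (∀ v, loc v < m) →
      ∃ (p : Prog) (b : Polynomial ℕ), ∀ y r S, (∀ v, S.reg (loc v) = ((r v : ℕ) : ℤ)) →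
        ∃ T c, Exec y.word p S T c ∧ c ≤ b.eval y.size ∧ T.out = S.out ∧
          (∀ i < m, T.reg i = S.reg i) ∧ T.reg m = f y r

/-- A list of integers that depends on a coded instance and on `k` indices can be written in
polynomial time. -/
def OutputComputable {k : ℕ} (g : (y : Code) → (Fin k → Fin y.n) → List ℤ) : Prop :=
  ∀ (loc : Fin k → ℕ) (m : ℕ), (∀ v, loc v < m) →
    ∃ (p : Prog) (b : Polynomial ℕ), ∀ y r S, (∀ v, S.reg (loc v) = ((r v : ℕ) : ℤ)) →
      ∃ T c, Exec y.word p S T c ∧ c ≤ b.eval y.size ∧ T.out = S.out ++ g y r ∧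
        (∀ i < m, T.reg i = S.reg i)

/-- A loop keeps its index in register `m'` and its counter in `m' + 1`; the body works from `m' +
2` on. -/
theorem cons_loc_lt {k m m' : ℕ} {loc : Fin k → ℕ} (h : ∀ v, loc v < m) (hm : m ≤ m') :
    ∀ v, (Fin.cons m' loc : Fin (k + 1) → ℕ) v < m' + 2 := by
  intro v
  refine Fin.cases ?_ (fun v => ?_) v
  · simp
  · have := h v
    simp only [Fin.cons_succ]
    omega

namespace IntComputable

variable {k : ℕ} {f g h : (y : Code) → (Fin k → Fin y.n) → ℤ}

theorem const (z : ℤ) : IntComputable (k := k) fun _ _ => z := by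
  refine ⟨⟨Polynomial.C (bits z), fun y r => by simp⟩, fun loc m _ =>
    ⟨.instr (.const m z), Polynomial.C (1 + bits z), fun y r S _ =>
      ⟨_, _, .instr _ _, by simp [Instr.cost], rfl, fun i hi => ?_, by simp [Instr.step]⟩⟩⟩
  exact State.set_reg_of_ne _ _ hi.ne

theorem var (v : Fin k) : IntComputable fun _ r => ((r v : ℕ) : ℤ) := by
  have hb : ∀ (y : Code) (r : Fin k → Fin y.n), bits ((r v : ℕ) : ℤ) ≤ y.size := fun y r =>
    (bits_natCast_le _).trans ((r v).2.le.trans (Code.n_le_size y))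
  refine ⟨⟨X, fun y r => by simpa using hb y r⟩, fun loc m _ =>
    ⟨.instr (.copy m (loc v)), 1 + X, fun y r S hS =>
      ⟨_, _, .instr _ _, ?_, rfl, fun i hi => ?_, by simp [Instr.step, hS]⟩⟩⟩
  · simpa [Instr.cost, hS] using hb y r
  · exact State.set_reg_of_ne _ _ hi.ne

theorem binOp (o : BinOp) (hf : IntComputable f) (hg : IntComputable g) :
    IntComputable fun y r => o.op (f y r) (g y r) := by
  obtain ⟨⟨bf, hbf⟩, hf⟩ := hf
  obtain ⟨⟨bg, hbg⟩, hg⟩ := hg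
  refine ⟨⟨bf + bg + 1, fun y r => ?_⟩, fun loc m hm => ?_⟩
  · simp only [Polynomial.eval_add, Polynomial.eval_one]
    linarith [o.bits_le (f y r) (g y r), hbf y r, hbg y r]
  obtain ⟨p, b, hp⟩ := hf loc m hm
  -- The second operand is computed above register `m`, which holds the first.
  obtain ⟨q, d, hq⟩ := hg loc (m + 1) fun v => (hm v).trans m.lt_succ_self
  refine ⟨.seq p (.seq q (.instr (o.instr m m (m + 1)))), b + (d + (1 + bf + bg)),
    fun y r S hS => ?_⟩
  obtain ⟨T, c, hT, hc, hTo, hTr, hTm⟩ := hp y r S hS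
  obtain ⟨U, c', hU, hc', hUo, hUr, hUm⟩ := hq y r T fun v => (hTr _ (hm v)).trans (hS v)
  have hUm' : U.reg m = f y r := (hUr m m.lt_succ_self).trans hTm
  refine ⟨_, _, .seq hT (.seq hU (.instr _ _)), ?_, ?_, fun i hi => ?_, ?_⟩
  · simp only [o.cost_eq, hUm, hUm', Polynomial.eval_add, Polynomial.eval_one]
    linarith [hbf y r, hbg y r]
  · rw [o.step_eq, State.set_out, hUo, hTo]
  · rw [o.step_eq, State.set_reg_of_ne _ _ hi.ne, hUr i (hi.trans m.lt_succ_self), hTr i hi]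
  · rw [o.step_eq, State.set_reg_self, hUm, hUm']

theorem add (hf : IntComputable f) (hg : IntComputable g) :
    IntComputable fun y r => f y r + g y r := hf.binOp addOp hg

theorem sub (hf : IntComputable f) (hg : IntComputable g) :
    IntComputable fun y r => f y r - g y r := hf.binOp subOp hg

theorem mul (hf : IntComputable f) (hg : IntComputable g) :
    IntComputable fun y r => f y r * g y r := hf.binOp mulOp hg

theorem read (hf : IntComputable f) :
    IntComputable fun y r => y.word.getD (f y r).toNat 0 := by
  obtain ⟨⟨bf, hbf⟩, hf⟩ := hf
  refine ⟨⟨X, fun y r => by simpa using bits_getD_le_bitLength _ _⟩, fun loc m hm => ?_⟩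
  obtain ⟨p, b, hp⟩ := hf loc m hm
  refine ⟨.seq p (.instr (.read m m)), b + (1 + bf + X), fun y r S hS => ?_⟩
  obtain ⟨T, c, hT, hc, hTo, hTr, hTm⟩ := hp y r S hS
  refine ⟨_, _, .seq hT (.instr _ _), ?_, hTo, fun i hi => ?_, ?_⟩
  · simp only [Instr.cost, hTm, Polynomial.eval_add, Polynomial.eval_one, Polynomial.eval_X]
    linarith [hbf y r, bits_getD_le_bitLength y.word (f y r).toNat]
  · exact (State.set_reg_of_ne _ _ hi.ne).trans (hTr i hi)
  · simp only [Instr.step, hTm, State.set_reg_self]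

theorem dim : IntComputable (k := k) fun y _ => (y.n : ℤ) := by
  simpa only [Int.toNat_zero, Code.word_getD_zero] using (const (k := k) 0).read

theorem ite (hf : IntComputable f) (hg : IntComputable g) (hh : IntComputable h) :
    IntComputable fun y r => if 0 < f y r then g y r else h y r := by
  obtain ⟨⟨bf, hbf⟩, hf⟩ := hf
  obtain ⟨⟨bg, hbg⟩, hg⟩ := hg
  obtain ⟨⟨bh, hbh⟩, hh⟩ := hh
  refine ⟨⟨bg + bh, fun y r => ?_⟩, fun loc m hm => ?_⟩
  · rw [Polynomial.eval_add]
    dsimp only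
    split_ifs
    · linarith [hbg y r]
    · linarith [hbh y r]
  obtain ⟨p, b, hp⟩ := hf loc m hm
  obtain ⟨q, d, hq⟩ := hg loc m hm
  obtain ⟨s, e, hs⟩ := hh loc m hm
  refine ⟨.seq p (.ite m q s), b + (1 + bf + (d + e)), fun y r S hS => ?_⟩
  obtain ⟨T, c, hT, hc, hTo, hTr, hTm⟩ := hp y r S hS
  have hS' : ∀ v, T.reg (loc v) = ((r v : ℕ) : ℤ) := fun v => (hTr _ (hm v)).trans (hS v)
  have hb := hbf y r
  by_cases hpos : 0 < f y r
  · obtain ⟨U, c', hU, hc', hUo, hUr, hUm⟩ := hq y r T hS'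
    refine ⟨U, _, .seq hT (.ite_pos (by rwa [hTm]) hU), ?_, hUo.trans hTo,
      fun i hi => (hUr i hi).trans (hTr i hi), hUm.trans (if_pos hpos).symm⟩
    simp only [hTm, Polynomial.eval_add, Polynomial.eval_one]
    omega
  · obtain ⟨U, c', hU, hc', hUo, hUr, hUm⟩ := hs y r T hS'
    refine ⟨U, _, .seq hT (.ite_neg (by rwa [hTm]) hU), ?_, hUo.trans hTo,
      fun i hi => (hUr i hi).trans (hTr i hi), hUm.trans (if_neg hpos).symm⟩
    simp only [hTm, Polynomial.eval_add, Polynomial.eval_one]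
    omega

theorem rename {k' : ℕ} (hf : IntComputable f) (ρ : Fin k → Fin k') :
    IntComputable fun y (r : Fin k' → Fin y.n) => f y fun v => r (ρ v) := by
  obtain ⟨⟨bf, hbf⟩, hf⟩ := hf
  refine ⟨⟨bf, fun y r => hbf y _⟩, fun loc m hm => ?_⟩
  obtain ⟨p, b, hp⟩ := hf (fun v => loc (ρ v)) m fun v => hm _
  exact ⟨p, b, fun y r S hS => hp y _ S fun v => hS _⟩

/-- Accumulation of the values of `F` by a binary operation, over all values of an index. -/
theorem fold (o : BinOp) (z : ℤ) {F : (y : Code) → (Fin (k + 1) → Fin y.n) → ℤ}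
    (hF : IntComputable F) {s : (y : Code) → (Fin k → Fin y.n) → ℕ → ℤ}
    (hs₀ : ∀ y r, s y r 0 = z)
    (hs : ∀ y r (a : Fin y.n), s y r (a + 1) = o.op (s y r a) (F y (Fin.cons a r))) :
    IntComputable fun y r => s y r y.n := by
  obtain ⟨⟨bF, hbF⟩, hF⟩ := hF
  -- Each pass adds at most `bF + 1` bits, for products as well as for sums.
  have hbits : ∀ (y : Code) r (a : ℕ), a ≤ y.n →
      bits (s y r a) ≤ bits z + a * (bF.eval y.size + 1) := by
    intro y r a
    induction a with
    | zero => intro _; rw [hs₀]; omega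
    | succ a ih =>
      intro ha
      have h₁ := ih (by omega)
      have h₂ := hbF y (Fin.cons ⟨a, ha⟩ r)
      have h₃ := o.bits_le (s y r a) (F y (Fin.cons ⟨a, ha⟩ r))
      rw [hs y r ⟨a, ha⟩, add_mul]
      dsimp only
      omega
  have hbits' : ∀ (y : Code) r (a : ℕ), a ≤ y.n →
      bits (s y r a) ≤ bits z + y.size * (bF.eval y.size + 1) := fun y r a ha =>
    (hbits y r a ha).trans (by gcongr; exact ha.trans (Code.n_le_size y))
  refine ⟨⟨Polynomial.C (bits z) + X * (bF + 1), fun y r => by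
    simpa using hbits' y r y.n le_rfl⟩, fun loc m hm => ?_⟩
  -- Register `m` accumulates, `m + 1` is the loop index, `m + 2` the counter. `m + 3` receives the
  -- value of `F`, which has been used up when `forProg` overwrites it.
  obtain ⟨p, b, hp⟩ := hF (Fin.cons (m + 1) loc) (m + 3) (cons_loc_lt hm m.le_succ)
  refine ⟨.seq (.instr (.const m z)) (forProg (m + 1) (.seq p (.instr (o.instr m m (m + 3))))),
    (1 + Polynomial.C (bits z)) + (X * (7 + 3 * X +
      (b + (1 + (Polynomial.C (bits z) + X * (bF + 1)) + bF))) + (3 + 2 * X)),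
    fun y r S hS => ?_⟩
  obtain ⟨T, c, hT, ⟨hTo, hTr, hTm⟩, hc⟩ := exec_forProg (l := y.word) (m := m + 1) (n := y.n)
    (p := .seq p (.instr (o.instr m m (m + 3))))
    (B := b.eval y.size + (1 + (bits z + y.size * (bF.eval y.size + 1)) + bF.eval y.size))
    (Inv := fun a T => T.out = S.out ∧ (∀ i < m, T.reg i = S.reg i) ∧ T.reg m = s y r a)
    y.word_getD_zero
    (fun a T U ho hr hInv => ⟨ho.trans hInv.1, fun i hi => (hr i (by omega)).trans (hInv.2.1 i hi),
      (hr m m.lt_succ_self).trans hInv.2.2⟩)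
    (by
      rintro a ha T ⟨hTo, hTr, hTm⟩ hTa
      have hloc : ∀ v, T.reg ((Fin.cons (m + 1) loc : Fin (k + 1) → ℕ) v) =
          (((Fin.cons ⟨a, ha⟩ r : Fin (k + 1) → Fin y.n) v : ℕ) : ℤ) := by
        intro v
        refine Fin.cases ?_ (fun v => ?_) v
        · simpa using hTa
        · simpa using (hTr _ (hm v)).trans (hS v)
      obtain ⟨U, c, hU, hc, hUo, hUr, hUm⟩ := hp y (Fin.cons ⟨a, ha⟩ r) T hloc
      have hUm' : U.reg m = s y r a := (hUr m (by omega)).trans hTm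
      refine ⟨_, _, .seq hU (.instr _ _), ?_, ⟨?_, fun i hi => ?_, ?_⟩, ?_, ?_⟩
      · rw [o.cost_eq, hUm, hUm']
        linarith [hbits' y r a ha.le, hbF y (Fin.cons ⟨a, ha⟩ r)]
      · rw [o.step_eq, State.set_out, hUo, hTo]
      · rw [o.step_eq, State.set_reg_of_ne _ _ hi.ne, hUr i (by omega), hTr i hi]
      · rw [o.step_eq, State.set_reg_self, hUm, hUm', hs y r ⟨a, ha⟩]
      · rw [o.step_eq, State.set_reg_of_ne _ _ (by omega), hUr _ (by omega)]
      · rw [o.step_eq, State.set_reg_of_ne _ _ (by omega), hUr _ (by omega)])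
    (S := S.set m z)
    ⟨rfl, fun i hi => State.set_reg_of_ne _ _ hi.ne, by rw [State.set_reg_self, hs₀]⟩
  refine ⟨T, _, .seq (.instr _ _) hT, ?_, hTo, hTr, hTm⟩
  have hle : y.n * (7 + 3 * y.n + (b.eval y.size +
        (1 + (bits z + y.size * (bF.eval y.size + 1)) + bF.eval y.size))) + (3 + 2 * y.n) ≤
      y.size * (7 + 3 * y.size + (b.eval y.size +
        (1 + (bits z + y.size * (bF.eval y.size + 1)) + bF.eval y.size))) + (3 + 2 * y.size) := by
    have := Code.n_le_size y
    gcongr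
  simpa [Instr.cost] using hc.trans hle

theorem sum {F : (y : Code) → (Fin (k + 1) → Fin y.n) → ℤ} (hF : IntComputable F) :
    IntComputable fun y r => ∑ a, F y (Fin.cons a r) := by
  have := hF.fold addOp 0 (s := fun y r a => ∑ i ∈ Finset.range a,
    if h : i < y.n then F y (Fin.cons ⟨i, h⟩ r) else 0) (fun _ _ => rfl)
    (fun y r a => by
      rw [Finset.sum_range_succ, dif_pos a.2]
      rfl)
  simpa [Finset.sum_range] using this

theorem prod {F : (y : Code) → (Fin (k + 1) → Fin y.n) → ℤ} (hF : IntComputable F) :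
    IntComputable fun y r => ∏ a, F y (Fin.cons a r) := by
  have := hF.fold mulOp 1 (s := fun y r a => ∏ i ∈ Finset.range a,
    if h : i < y.n then F y (Fin.cons ⟨i, h⟩ r) else 1) (fun _ _ => rfl)
    (fun y r a => by
      rw [Finset.prod_range_succ, dif_pos a.2]
      rfl)
  simpa [Finset.prod_range] using this

theorem ite_eq (u v : Fin k) (hg : IntComputable g) (hh : IntComputable h) :
    IntComputable fun y r => if r u = r v then g y r else h y r := by
  have hd := (var u).sub (var v)
  -- The machine tests only for positivity; for an integer `d`, `0 < 1 - d * d` holds exactly if `d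
  -- = 0`.
  have := ((const 1).sub (hd.mul hd)).ite hg hh
  convert this using 4 with y r
  rw [Fin.ext_iff, ← Nat.cast_inj (R := ℤ), ← sub_eq_zero (a := (((r u : ℕ) : ℤ)))]
  generalize (((r u : ℕ) : ℤ)) - ((r v : ℕ) : ℤ) = d
  constructor
  · rintro rfl
    norm_num
  · intro h
    by_contra hd
    nlinarith [Int.one_le_abs hd, sq_abs d]

end IntComputable

/-! ### Lists that can be written in polynomial time -/

namespace OutputComputable

variable {k : ℕ} {f g : (y : Code) → (Fin k → Fin y.n) → List ℤ}

theorem write {f : (y : Code) → (Fin k → Fin y.n) → ℤ} (hf : IntComputable f) :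
    OutputComputable fun y r => [f y r] := by
  obtain ⟨⟨bf, hbf⟩, hf⟩ := hf
  intro loc m hm
  obtain ⟨p, b, hp⟩ := hf loc m hm
  refine ⟨.seq p (.instr (.write m)), b + (1 + bf), fun y r S hS => ?_⟩
  obtain ⟨T, c, hT, hc, hTo, hTr, hTm⟩ := hp y r S hS
  refine ⟨_, _, .seq hT (.instr _ _), ?_, ?_, hTr⟩
  · simp only [Instr.cost, hTm, Polynomial.eval_add, Polynomial.eval_one]
    linarith [hbf y r]
  · simp only [Instr.step, hTm, hTo]

theorem append (hf : OutputComputable f) (hg : OutputComputable g) :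
    OutputComputable fun y r => f y r ++ g y r := by
  intro loc m hm
  obtain ⟨p, b, hp⟩ := hf loc m hm
  obtain ⟨q, d, hq⟩ := hg loc m hm
  refine ⟨.seq p q, b + d, fun y r S hS => ?_⟩
  obtain ⟨T, c, hT, hc, hTo, hTr⟩ := hp y r S hS
  obtain ⟨U, c', hU, hc', hUo, hUr⟩ := hq y r T fun v => (hTr _ (hm v)).trans (hS v)
  refine ⟨U, _, .seq hT hU, ?_, by rw [hUo, hTo, List.append_assoc],
    fun i hi => (hUr i hi).trans (hTr i hi)⟩
  rw [Polynomial.eval_add]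
  omega

theorem flatten {F : (y : Code) → (Fin (k + 1) → Fin y.n) → List ℤ} (hF : OutputComputable F) :
    OutputComputable fun y r => (List.ofFn fun a => F y (Fin.cons a r)).flatten := by
  intro loc m hm
  obtain ⟨p, b, hp⟩ := hF (Fin.cons m loc) (m + 2) (cons_loc_lt hm le_rfl)
  refine ⟨forProg m p, X * (7 + 3 * X + b) + (3 + 2 * X), fun y r S hS => ?_⟩
  obtain ⟨T, c, hT, ⟨hTo, hTr⟩, hc⟩ := exec_forProg (l := y.word) (m := m) (n := y.n)
    (p := p) (B := b.eval y.size)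
    (Inv := fun a T => T.out = S.out ++ ((List.ofFn fun a => F y (Fin.cons a r)).take a).flatten ∧
      ∀ i < m, T.reg i = S.reg i)
    y.word_getD_zero
    (fun a T U ho hr hInv => ⟨ho.trans hInv.1, fun i hi => (hr i hi).trans (hInv.2 i hi)⟩)
    (by
      rintro a ha T ⟨hTo, hTr⟩ hTa
      have hloc : ∀ v, T.reg ((Fin.cons m loc : Fin (k + 1) → ℕ) v) =
          (((Fin.cons ⟨a, ha⟩ r : Fin (k + 1) → Fin y.n) v : ℕ) : ℤ) := by
        intro v
        refine Fin.cases ?_ (fun v => ?_) v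
        · simpa using hTa
        · simpa using (hTr _ (hm v)).trans (hS v)
      obtain ⟨U, c, hU, hc, hUo, hUr⟩ := hp y (Fin.cons ⟨a, ha⟩ r) T hloc
      refine ⟨U, c, hU, hc, ⟨?_, fun i hi => ?_⟩, hUr _ (by omega), hUr _ (by omega)⟩
      · rw [hUo, hTo, List.append_assoc, List.take_add_one,
          List.getElem?_eq_getElem (by simpa using ha)]
        simp
      · rw [hUr i (by omega), hTr i hi])
    (S := S) ⟨by simp, fun i hi => rfl⟩
  refine ⟨T, c, hT, ?_, ?_, hTr⟩
  · have hle : y.n * (7 + 3 * y.n + b.eval y.size) + (3 + 2 * y.n) ≤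
        y.size * (7 + 3 * y.size + b.eval y.size) + (3 + 2 * y.size) := by
      have := Code.n_le_size y
      gcongr
    simpa using hc.trans hle
  · rw [hTo, List.take_of_length_le (by simp)]

end OutputComputable

end RAM

/-! ### Rational functions computable in polynomial time -/

namespace RAM

open QAP (Code)

/-- A rational number that depends on an instance with a threshold and on `k` indices can be
computed from every code of the instance in polynomial time. -/
def RatComputable {k : ℕ} (q : (x : QAP ℚ × ℚ) → (Fin k → Fin x.1.n) → ℚ) : Prop :=
  ∃ num den : (y : Code) → (Fin k → Fin y.n) → ℤ, IntComputable num ∧ IntComputable den ∧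
    ∀ y r, 0 < den y r ∧ q y.x r = (num y r : ℚ) / (den y r : ℚ)

namespace RatComputable

variable {k : ℕ} {p q : (x : QAP ℚ × ℚ) → (Fin k → Fin x.1.n) → ℚ}

theorem const (z : ℤ) : RatComputable (k := k) fun _ _ => (z : ℚ) :=
  ⟨_, _, .const z, .const 1, fun _ _ => ⟨one_pos, by simp⟩⟩

theorem dim : RatComputable (k := k) fun x _ => (x.1.n : ℚ) :=
  ⟨_, _, .dim, .const 1, fun _ _ => ⟨one_pos, by simp⟩⟩

theorem add (hp : RatComputable p) (hq : RatComputable q) :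
    RatComputable fun x r => p x r + q x r := by
  obtain ⟨a, b, ha, hb, hp⟩ := hp
  obtain ⟨c, d, hc, hd, hq⟩ := hq
  refine ⟨_, _, (ha.mul hd).add (hb.mul hc), hb.mul hd, fun y r =>
    ⟨mul_pos (hp y r).1 (hq y r).1, ?_⟩⟩
  have h₁ : (b y r : ℚ) ≠ 0 := by exact_mod_cast (hp y r).1.ne'
  have h₂ : (d y r : ℚ) ≠ 0 := by exact_mod_cast (hq y r).1.ne'
  dsimp only
  rw [(hp y r).2, (hq y r).2, div_add_div _ _ h₁ h₂]
  push_cast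
  rfl

theorem mul (hp : RatComputable p) (hq : RatComputable q) :
    RatComputable fun x r => p x r * q x r := by
  obtain ⟨a, b, ha, hb, hp⟩ := hp
  obtain ⟨c, d, hc, hd, hq⟩ := hq
  refine ⟨_, _, ha.mul hc, hb.mul hd, fun y r => ⟨mul_pos (hp y r).1 (hq y r).1, ?_⟩⟩
  dsimp only
  rw [(hp y r).2, (hq y r).2, div_mul_div_comm]
  push_cast
  rfl

theorem neg (hp : RatComputable p) : RatComputable fun x r => -p x r := by
  simpa using (const (-1)).mul hp

theorem max_zero (hp : RatComputable p) : RatComputable fun x r => max (p x r) 0 := by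
  obtain ⟨a, b, ha, hb, hp⟩ := hp
  refine ⟨_, _, ha.ite ha (.const 0), hb, fun y r => ⟨(hp y r).1, ?_⟩⟩
  have hpos : (0 : ℚ) < b y r := by exact_mod_cast (hp y r).1
  dsimp only
  rw [(hp y r).2]
  split_ifs with h
  · exact max_eq_left (div_nonneg (by exact_mod_cast h.le) hpos.le)
  · rw [Int.cast_zero, zero_div]
    exact max_eq_right (div_nonpos_of_nonpos_of_nonneg (by exact_mod_cast not_lt.1 h) hpos.le)

theorem ite_eq (u v : Fin k) (hp : RatComputable p) (hq : RatComputable q) :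
    RatComputable fun x r => if r u = r v then p x r else q x r := by
  obtain ⟨a, b, ha, hb, hp⟩ := hp
  obtain ⟨c, d, hc, hd, hq⟩ := hq
  refine ⟨_, _, ha.ite_eq u v hc, hb.ite_eq u v hd, fun y r => ?_⟩
  dsimp only
  split_ifs
  · exact hp y r
  · exact hq y r

theorem rename {k' : ℕ} (hp : RatComputable p) (ρ : Fin k → Fin k') :
    RatComputable fun x (r : Fin k' → Fin x.1.n) => p x fun v => r (ρ v) := by
  obtain ⟨a, b, ha, hb, hp⟩ := hp
  exact ⟨_, _, ha.rename ρ, hb.rename ρ, fun y r => hp y _⟩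

/-- `IntComputable.fold` accumulates a single integer, so numerator and denominator cannot be
updated together. This form computes each by sums and products alone. -/
theorem sum_div_eq {ι : Type} [Fintype ι] [DecidableEq ι] (N D : ι → ℚ) (hD : ∀ a, D a ≠ 0) :
    ∑ a, N a / D a = (∑ a, ∏ b, if b = a then N b else D b) / ∏ b, D b := by
  rw [Finset.sum_div]
  refine Finset.sum_congr rfl fun a _ => ?_
  rw [← Finset.mul_prod_erase _ _ (Finset.mem_univ a), ← Finset.mul_prod_erase _ D
    (Finset.mem_univ a), if_pos rfl,
    Finset.prod_congr rfl fun b hb => if_neg (Finset.ne_of_mem_erase hb),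
    mul_div_mul_right _ _ (Finset.prod_ne_zero_iff.2 fun b _ => hD b)]

theorem sum {F : (x : QAP ℚ × ℚ) → (Fin (k + 1) → Fin x.1.n) → ℚ} (hF : RatComputable F) :
    RatComputable fun x r => ∑ a, F x (Fin.cons a r) := by
  obtain ⟨a, b, ha, hb, hF⟩ := hF
  -- Index `0` runs over the factors and index `1` over the summands; `ρ` forgets the latter.
  let ρ : Fin (k + 1) → Fin (k + 2) := Fin.cons 0 fun v => v.succ.succ
  have hρ : ∀ (y : Code) (r : Fin k → Fin y.n) (i j : Fin y.n),
      (fun v => (Fin.cons i (Fin.cons j r : Fin (k + 1) → Fin y.n) : Fin (k + 2) → Fin y.n) (ρ v)) =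
        (Fin.cons i r : Fin (k + 1) → Fin y.n) := by
    intro y r i j
    funext v
    refine Fin.cases ?_ (fun v => ?_) v <;> simp [ρ]
  have hnum := ((ha.rename ρ).ite_eq 0 1 (hb.rename ρ)).prod.sum
  refine ⟨_, _, hnum, hb.prod, fun y r => ⟨Finset.prod_pos fun i _ => (hF y _).1, ?_⟩⟩
  simp only [hρ, (hF y _).2, Fin.cons_zero, Fin.cons_one]
  rw [sum_div_eq _ _ fun i => by exact_mod_cast (hF y _).1.ne']
  push_cast
  rfl

/-- Access to a coded number whose position is computable. -/
theorem entry {pos : (y : Code) → (Fin k → Fin y.n) → ℤ} (hpos : IntComputable pos)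
    {i : (x : QAP ℚ × ℚ) → (Fin k → Fin x.1.n) → ℕ} (hi : ∀ y r, pos y r = i y.x r)
    (hq : ∀ x r, (entries x)[i x r]? = some (q x r)) : RatComputable q := by
  -- The word starts with `n`, and then each rational takes two places.
  have h₁ := ((IntComputable.const 2).mul hpos).add (.const 1)
  have h₂ := ((IntComputable.const 2).mul hpos).add (.const 2)
  refine ⟨_, _, h₁.read, h₂.read, fun y r => ?_⟩
  obtain ⟨l', h, h'⟩ := y.enc
  have hpos₁ : (2 * pos y r + 1).toNat = 2 * i y.x r + 1 := by rw [hi]; omega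
  have hpos₂ : (2 * pos y r + 2).toNat = 2 * i y.x r + 1 + 1 := by rw [hi]; omega
  rw [hpos₁, hpos₂, h, List.getD_cons_succ, List.getD_cons_succ]
  exact h'.getD (hq y.x r)

theorem intComputable_index (u v : Fin k) :
    IntComputable fun y r => ((r u : ℕ) : ℤ) * y.n + ((r v : ℕ) : ℤ) :=
  ((IntComputable.var u).mul .dim).add (.var v)

theorem index_lt {n : ℕ} (i j : Fin n) : (i : ℕ) * n + j < n * n := by
  have h : ((i : ℕ) + 1) * n ≤ n * n := Nat.mul_le_mul_right n i.2
  rw [add_mul] at h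
  omega

theorem A (u v : Fin k) : RatComputable fun x r => x.1.A (r u) (r v) := by
  refine entry (intComputable_index u v) (i := fun x r => (r u : ℕ) * x.1.n + r v)
    (fun y r => by push_cast; rfl) fun x r => ?_
  have := index_lt (r u) (r v)
  rw [entries, List.getElem?_append_left (by simp [length_rows]; omega),
    List.getElem?_append_left (by simp [length_rows]; omega),
    List.getElem?_append_left (by simp [length_rows]; omega), rows_getElem?]

theorem B (u v : Fin k) : RatComputable fun x r => x.1.B (r u) (r v) := by
  refine entry ((IntComputable.dim.mul .dim).add (intComputable_index u v))
    (i := fun x r => x.1.n * x.1.n + ((r u : ℕ) * x.1.n + r v))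
    (fun y r => by push_cast; rfl) fun x r => ?_
  have := index_lt (r u) (r v)
  rw [entries, List.getElem?_append_left (by simp [length_rows]; omega),
    List.getElem?_append_left (by simp [length_rows]; omega),
    List.getElem?_append_right (by simp [length_rows]), length_rows, Nat.add_sub_cancel_left,
    rows_getElem?]

theorem C (u v : Fin k) : RatComputable fun x r => x.1.C (r u) (r v) := by
  refine entry (((IntComputable.dim.mul .dim).add (.mul .dim .dim)).add (intComputable_index u v))
    (i := fun x r => (x.1.n * x.1.n + x.1.n * x.1.n) + ((r u : ℕ) * x.1.n + r v))
    (fun y r => by push_cast; rfl) fun x r => ?_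
  have := index_lt (r u) (r v)
  rw [entries, List.getElem?_append_left (by simp [length_rows]; omega),
    List.getElem?_append_right (by simp [length_rows]), List.length_append, length_rows,
    length_rows, Nat.add_sub_cancel_left, rows_getElem?]

theorem threshold : RatComputable (k := k) fun x _ => x.2 := by
  refine entry (((IntComputable.dim.mul .dim).add (.mul .dim .dim)).add (.mul .dim .dim))
    (i := fun x r => (x.1.n * x.1.n + x.1.n * x.1.n) + x.1.n * x.1.n)
    (fun y r => by push_cast; rfl) fun x r => ?_
  rw [entries, List.getElem?_append_right (by simp [length_rows, add_assoc])]
  simp [length_rows, add_assoc]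

end RatComputable

/-- Fractions for a list of rational numbers that depends on an instance with a threshold and on `k`
indices can be written in polynomial time. -/
def RatsComputable {k : ℕ} (q : (x : QAP ℚ × ℚ) → (Fin k → Fin x.1.n) → List ℚ) : Prop :=
  ∃ g : (y : Code) → (Fin k → Fin y.n) → List ℤ, OutputComputable g ∧
    ∀ y r, EncRats (q y.x r) (g y r)

namespace RatsComputable

variable {k : ℕ}

theorem flatten_ofFn_singleton {α : Type} {n : ℕ} (f : Fin n → α) :
    (List.ofFn fun a => [f a]).flatten = List.ofFn f := by
  induction n with
  | zero => simp
  | succ n ih => simp [List.ofFn_succ, ih]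

theorem singleton {q : (x : QAP ℚ × ℚ) → (Fin k → Fin x.1.n) → ℚ} (hq : RatComputable q) :
    RatsComputable fun x r => [q x r] := by
  obtain ⟨a, b, ha, hb, hq⟩ := hq
  exact ⟨_, (OutputComputable.write ha).append (.write hb), fun y r =>
    .cons (hq y r).1 (hq y r).2 .nil⟩

theorem ofFn {F : (x : QAP ℚ × ℚ) → (Fin (k + 1) → Fin x.1.n) → ℚ} (hF : RatComputable F) :
    RatsComputable fun x r => List.ofFn fun a => F x (Fin.cons a r) := by
  obtain ⟨g, hg, hF⟩ := singleton hF
  refine ⟨_, hg.flatten, fun y r => ?_⟩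
  have := EncRats.flatten_ofFn fun a => hF y (Fin.cons a r)
  rwa [flatten_ofFn_singleton] at this

theorem append {p q : (x : QAP ℚ × ℚ) → (Fin k → Fin x.1.n) → List ℚ} (hp : RatsComputable p)
    (hq : RatsComputable q) : RatsComputable fun x r => p x r ++ q x r := by
  obtain ⟨f, hf, hp⟩ := hp
  obtain ⟨g, hg, hq⟩ := hq
  exact ⟨_, hf.append hg, fun y r => (hp y r).append (hq y r)⟩

theorem flatten {F : (x : QAP ℚ × ℚ) → (Fin (k + 1) → Fin x.1.n) → List ℚ}
    (hF : RatsComputable F) :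
    RatsComputable fun x r => (List.ofFn fun a => F x (Fin.cons a r)).flatten := by
  obtain ⟨g, hg, hF⟩ := hF
  exact ⟨_, hg.flatten, fun y r => .flatten_ofFn fun a => hF y _⟩

end RatsComputable

end RAM

/-! ### The program for the reduction -/

namespace QAP

/-- Arcs are numbered by location first and facility second, so a list over all arcs can be written
by two nested loops of length `n`. -/
theorem ofFn_arc {R α : Type} [CommRing R] (I : QAP R) (M σ τ : R)
    (f : Fin (I.toQSPP M σ τ).nA → α) :
    List.ofFn f = (List.ofFn fun j => List.ofFn fun i => f (I.arc M σ τ j i)).flatten := by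
  refine (List.ofFn_mul (m := I.n) (n := I.n) f).trans ?_
  congr 2
  funext j
  congr 1
  funext i
  exact congrArg f (Fin.ext (show (j : ℕ) * I.n + i = i + I.n * j by ring))

end QAP

namespace RAM

open QAP (Code)

namespace RatComputable

variable {k : ℕ}

/-- A number that does not depend on indices may be used in the scope of indices. -/
theorem weaken {q : QAP ℚ × ℚ → ℚ} (hq : RatComputable (k := 0) fun x _ => q x) :
    RatComputable (k := k) fun x _ => q x :=
  hq.rename Fin.elim0

theorem pairShift : RatComputable (k := k) fun x _ => x.1.pairShift := by
  refine weaken ?_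
  -- `Fin.cons` puts the innermost summation index first: `i`, `k`, `j`, `l` have the numbers `3`,
  -- `2`, `1`, `0`.
  have h := ite_eq (k := 4) 3 2 (const 0) (ite_eq 1 0 (const 0) ((A 3 2).mul (B 1 0)).neg.max_zero)
  simp only [Int.cast_zero] at h
  exact h.sum.sum.sum.sum

theorem arcShift : RatComputable (k := k) fun x _ => x.1.arcShift := by
  refine weaken ?_
  have h := ((C (k := 2) 1 0).add ((A 1 1).mul (B 0 0))).neg.max_zero
  exact h.sum.sum

theorem penalty : RatComputable (k := k) fun x _ => x.1.penalty := by
  refine weaken ?_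
  have h₁ := ((C (k := 2) 1 0).add ((A 1 1).mul (B 0 0))).add arcShift
  have h₂ := ite_eq (k := 4) 3 2 (const 0)
    (ite_eq 1 0 (const 0) (((A 3 2).mul (B 1 0)).add pairShift))
  have h₀ := const (k := 0) 1
  simp only [Int.cast_zero] at h₂
  simp only [Int.cast_one] at h₀
  exact (h₀.add h₁.sum.sum).add h₂.sum.sum.sum.sum

theorem offset : RatComputable (k := k) fun x _ => x.1.offset x.1.pairShift x.1.arcShift := by
  have h := dim (k := k).add (const (-1))
  simp only [Int.cast_neg, Int.cast_one, ← sub_eq_add_neg] at h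
  exact ((dim.mul h).mul pairShift).add (dim.mul arcShift)

end RatComputable

/-- The constructed instance of the quadratic shortest path problem with its threshold. -/
abbrev reduce (x : QAP ℚ × ℚ) : QSPP ℚ × ℚ :=
  (x.1.reduction, x.2 + x.1.offset x.1.pairShift x.1.arcShift)

theorem ratsComputable_c : RatsComputable (k := 0) fun x _ => List.ofFn x.1.reduction.c := by
  have h := ((RatComputable.C (k := 2) 0 1).add ((RatComputable.A 0 0).mul (.B 1 1))).add .arcShift
  have h' := (RatsComputable.ofFn h).flatten
  simp only [QAP.ofFn_arc, QAP.c_arc]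
  exact h'

theorem ratsComputable_Q : RatsComputable (k := 0) fun x _ => rows x.1.reduction.Q := by
  have h₀ := RatComputable.const (k := 4) 0
  simp only [Int.cast_zero] at h₀
  -- The loops run over `j`, `i`, `l`, `k`, numbered `3`, `2`, `1`, `0`.
  have h := RatComputable.ite_eq 3 1 (.ite_eq 2 0 h₀ .penalty)
    (.ite_eq 2 0 .penalty (((RatComputable.A 2 0).mul (.B 3 1)).add .pairShift))
  have h' := (RatsComputable.ofFn h).flatten.flatten.flatten
  -- Nested tests of one equality each replace the compound conditions in `Q_arc`.
  have hQ : ∀ (I : QAP ℚ) (j i l k : Fin I.n),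
      I.reduction.Q (I.arc _ _ _ j i) (I.arc _ _ _ l k) =
        if j = l then (if i = k then 0 else I.penalty)
        else if i = k then I.penalty else I.A i k * I.B j l + I.pairShift := by
    intro I j i l k
    rw [QAP.Q_arc]
    split_ifs <;> simp_all
  simp only [rows, QAP.ofFn_arc, hQ, List.flatten_flatten, List.map_ofFn, Function.comp_def]
  exact h'

theorem polyTimeComputable_reduce : PolyTimeComputable QAP.Enc QSPP.Enc reduce := by
  have hthr : RatComputable (k := 0) fun x _ => (reduce x).2 := RatComputable.threshold.add .offset
  obtain ⟨g, hg, hgenc⟩ := (ratsComputable_c.append ratsComputable_Q).append (.singleton hthr)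
  -- Index `1` is the location; the inner index, the facility, does not affect the end points of an
  -- arc.
  have hv := IntComputable.var (k := 2) 1
  have harcs := ((OutputComputable.write hv).append (.write (hv.add (.const 1)))).flatten.flatten
  have hhead := (OutputComputable.write (k := 0) (IntComputable.dim.add (.const 1))).append
    ((OutputComputable.write (IntComputable.dim.mul .dim)).append
      ((OutputComputable.write (.const 0)).append (.write .dim)))
  obtain ⟨p, b, hp⟩ := ((hhead.append harcs).append hg) Fin.elim0 0 fun v => v.elim0
  refine ⟨p, b, fun x l hl => ?_⟩
  obtain ⟨T, c, hT, hc, hTo, -⟩ := hp ⟨x, l, hl⟩ Fin.elim0 State.init fun v => v.elim0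
  refine ⟨T, c, hT, ⟨g ⟨x, l, hl⟩ Fin.elim0, ?_, hgenc ⟨x, l, hl⟩ Fin.elim0⟩, hc⟩
  rw [hTo]
  simp only [QAP.ofFn_arc, QAP.src_arc, QAP.tgt_arc, List.flatten_flatten, List.map_ofFn,
    Function.comp_def]
  change [] ++ _ = _
  rw [List.nil_append]
  congr 1

end RAM

theorem theorem1 :
    (∀ I : QAP ℝ, ∃ M σ τ : ℝ, I.ReducesWith M σ τ) ∧
    ∃ M σ τ : QAP ℚ → ℚ,
      (∀ I : QAP ℚ, I.ReducesWith (M I) (σ I) (τ I)) ∧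
      (∀ I : QAP ℚ, (I.toQSPP (M I) (σ I) (τ I)).nV = I.n + 1 ∧
        (I.toQSPP (M I) (σ I) (τ I)).nA = I.n ^ 2) ∧
      RAM.IsPolyTimeReduction QAP.Enc QAP.Yes QSPP.Enc QSPP.Yes
        (fun x => (x.1.toQSPP (M x.1) (σ x.1) (τ x.1), x.2 + x.1.offset (σ x.1) (τ x.1))) :=
  ⟨fun I => ⟨_, _, _, I.reducesWith⟩, QAP.penalty, QAP.pairShift, QAP.arcShift,
    fun I => I.reducesWith, fun I => ⟨rfl, (sq I.n).symm⟩, RAM.polyTimeComputable_reduce,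
    -- The legality demanded by `QSPP.Yes` always holds for constructed instances.
    fun x => (x.1.exists_cost_le_iff x.2).trans (and_iff_right x.1.valid_reduction).symm⟩
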